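/- Let $(\mathcal K,[\cdot,\cdot])$ be a Krein space, let $\mathcal V,\mathcal V_1,\mathcal V_2$ be complex Hilbert spaces and let $T:\mathcal V\to\mathcal K$, $T_1:\mathcal V_1\to\mathcal K$, $T_2:\mathcal V_2\to\mathcal K$ be bounded, linear, injective mappings with $TT^*=T_1T_1^*+T_2T_2^*$, where $*$ denotes the adjoint with respect to $[\cdot,\cdot]$ on $\mathcal K$ and the Hilbert space inner products. For $j=1,2$ let $R_j:\mathcal V_j\to\mathcal V$ be the adjoint of the unique bounded linear extension to $\mathcal V$ of the mapping $T^*x\mapsto T_j^*x$ on the dense subspace $\operatorname{ran}T^*$; equivalently, $R_j$ is the unique operator with $TR_j=T_j$. Write $C'$ for the commutant of $\{C\}$, i.e. the set of all bounded operators on the same space that commute with $C$. For $C\in (TT^*)'$, $C\in(T_jT_j^*)'$, $D\in(R_jR_j^*)'$, respectively, let $$\Theta(C)=T^{-1}CT,\qquad \Theta_j(C)=T_j^{-1}CT_j,\qquad \Gamma_j(D)=R_j^{-1}DR_j ,$$ i.e. $\Theta(C)$ is the unique bounded operator on $\mathcal V$ with $T\Theta(C)=CT$, and likewise $T_j\Theta_j(C)=CT_j$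 on $\mathcal V_j$ and $R_j\Gamma_j(D)=DR_j$ on $\mathcal V_j$. Let $N$ be a bounded linear operator on $\mathcal K$ which is normal, $NN^*=N^*N$, and satisfies $N\in(T_1T_1^*)'\cap(T_2T_2^*)'$. Then $\Theta(N)$, $\Theta_1(N)$, $\Theta_2(N)$ exist as bounded operators and are normal operators in the Hilbert spaces $\mathcal V$, $\mathcal V_1$, $\mathcal V_2$, respectively, and $\sigma(\Theta_j(N))\subseteq\sigma(\Theta(N))$ for $j=1,2$. Let $E$, $E_1$, $E_2$ denote the spectral measures of $\Theta(N)$, $\Theta_1(N)$, $\Theta_2(N)$. Then for every Borel set $\Delta\subseteq\mathbb C$ and $j=1,2$, $$E(\Delta)\in(R_1R_1^*)'\cap(R_2R_2^*)'\cap(T^*T)',\qquad \Gamma_j(E(\Delta))=E_j(\Delta)\in(R_j^*R_j)'\cap(T_j^*T_j)'.$$ Moreover, for every bounded and measurable $h:\sigma(\Theta(N))\to\mathbb C$ and $j=1,2$, $$\int_{\sigma(\Theta(N))}h\,dE\in(R_1R_1^*)'\cap(R_2R_2^*)'\cap(T^*T)',\qquad \Gamma_j\Big(\int_{\sigma(\Theta(N))}h\,dE\Big)=\int_{\sigma(\Theta_j(N))}h\,dE_j\in(R_j^*R_j)'\cap(T_j^*T_j)'.$$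 Here $\Gamma_j(E(\Delta))$, $\Gamma_j(\int h\,dE)$ and all integrals exist as bounded operators. -/

import Mathlib

open MeasureTheory ContinuousLinearMap
open scoped InnerProductSpace ENNReal

noncomputable section

/-! ### Krein spaces and Krein space adjoints -/

/-- A Krein space, presented by a Hilbert space inner product that defines its topology and by a
fundamental symmetry `J` (a bounded selfadjoint involution). The indefinite inner product is
`[x, y] = ⟪x, J y⟫`. -/
class KreinSpace (K : Type*) [NormedAddCommGroup K] [InnerProductSpace ℂ K]
    [CompleteSpace K] where
  /-- The fundamental symmetry. -/
  J : K →L[ℂ] K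
  isSelfAdjoint_J : IsSelfAdjoint J
  J_mul_J : J * J = 1

section Krein

variable {V K : Type*} [NormedAddCommGroup V] [InnerProductSpace ℂ V] [CompleteSpace V]
  [NormedAddCommGroup K] [InnerProductSpace ℂ K] [CompleteSpace K] [KreinSpace K]

/-- The indefinite inner product of a Krein space (antilinear in the first variable, as Mathlib's
`inner`). -/
def kreinForm (x y : K) : ℂ := ⟪x, KreinSpace.J y⟫_ℂ

/-- The adjoint `T⁺ : K → V` of a bounded operator `T` from a Hilbert space `V` to a
Krein space `K`. -/
def kreinAdjoint (T : V →L[ℂ] K) : K →L[ℂ] V := adjoint T ∘L KreinSpace.J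

/-- The Krein space adjoint `C⁺` of a bounded operator `C` on a Krein space. -/
def kreinAdjointEnd (C : K →L[ℂ] K) : K →L[ℂ] K := KreinSpace.J ∘L adjoint C ∘L KreinSpace.J

theorem kreinForm_apply_left (T : V →L[ℂ] K) (v : V) (x : K) :
    kreinForm (T v) x = ⟪v, kreinAdjoint T x⟫_ℂ := by
  simp [kreinForm, kreinAdjoint, adjoint_inner_right]

theorem kreinForm_end_apply_left (C : K →L[ℂ] K) (x y : K) :
    kreinForm (C x) y = kreinForm x (kreinAdjointEnd C y) := by
  have h : ∀ z : K, KreinSpace.J (KreinSpace.J z) = z := fun z => by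
    have := congrArg (fun A : K →L[ℂ] K => A z) (KreinSpace.J_mul_J (K := K))
    simpa using this
  simp [kreinForm, kreinAdjointEnd, adjoint_inner_right, h]

/-- For `T T⁺ = T₁ T₁⁺ + T₂ T₂⁺` with `T` injective, the adjoint `R₁ : V₁ → V` of the unique bounded
extension to `V` of the mapping `T⁺ x ↦ T₁⁺ x` on the (dense) range of `T⁺`. -/
def connecting {V₁ : Type*} [NormedAddCommGroup V₁] [InnerProductSpace ℂ V₁] [CompleteSpace V₁]
    (T : V →L[ℂ] K) (T₁ : V₁ →L[ℂ] K) : V₁ →L[ℂ] V :=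
  adjoint (LinearMap.extendOfNorm (kreinAdjoint T₁ : K →ₗ[ℂ] V₁) (kreinAdjoint T : K →ₗ[ℂ] V))

theorem denseRange_kreinAdjoint (T : V →L[ℂ] K) (hT : Function.Injective T) :
    DenseRange (kreinAdjoint T : K →ₗ[ℂ] V) := by
  have h : (LinearMap.range (kreinAdjoint T : K →ₗ[ℂ] V)).topologicalClosure = ⊤ := by
    rw [Submodule.topologicalClosure_eq_top_iff, Submodule.eq_bot_iff]
    intro v hv
    have h1 : ∀ x : K, ⟪T v, KreinSpace.J x⟫_ℂ = 0 := fun x => by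
      have h2 := (Submodule.mem_orthogonal' _ _).1 hv _ (LinearMap.mem_range_self _ x)
      have h3 := kreinForm_apply_left T v x
      rw [kreinForm] at h3
      exact h3.trans h2
    have h4 := h1 (KreinSpace.J (T v))
    have h5 : KreinSpace.J (KreinSpace.J (T v)) = T v :=
      congrArg (fun A : K →L[ℂ] K => A (T v)) (KreinSpace.J_mul_J (K := K))
    rw [h5, inner_self_eq_zero] at h4
    exact hT (by rw [h4, map_zero])
  have h6 := (Submodule.dense_iff_topologicalClosure_eq_top).2 h
  exact h6

theorem norm_kreinAdjoint_sq (T : V →L[ℂ] K) (x : K) :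
    ‖kreinAdjoint T x‖ ^ 2 = (kreinForm ((T ∘L kreinAdjoint T) x) x).re := by
  rw [ContinuousLinearMap.comp_apply, kreinForm_apply_left, inner_self_eq_norm_sq_to_K]
  norm_cast

/-- The defining property of `connecting`, in the equivalent form `T R₁ = T₁`. -/
theorem comp_connecting {V₁ V₂ : Type*}
    [NormedAddCommGroup V₁] [InnerProductSpace ℂ V₁] [CompleteSpace V₁]
    [NormedAddCommGroup V₂] [InnerProductSpace ℂ V₂] [CompleteSpace V₂]
    (T : V →L[ℂ] K) (T₁ : V₁ →L[ℂ] K) (T₂ : V₂ →L[ℂ] K) (hT : Function.Injective T)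
    (hsum : T ∘L kreinAdjoint T = T₁ ∘L kreinAdjoint T₁ + T₂ ∘L kreinAdjoint T₂) :
    T ∘L connecting T T₁ = T₁ := by
  have hn : ∀ x : K, ‖kreinAdjoint T₁ x‖ ≤ 1 * ‖kreinAdjoint T x‖ := fun x => by
    have h : ‖kreinAdjoint T x‖ ^ 2 = ‖kreinAdjoint T₁ x‖ ^ 2 + ‖kreinAdjoint T₂ x‖ ^ 2 := by
      rw [norm_kreinAdjoint_sq, norm_kreinAdjoint_sq, norm_kreinAdjoint_sq, hsum]
      simp [kreinForm]
    rw [one_mul]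
    exact le_of_sq_le_sq (by nlinarith [sq_nonneg ‖kreinAdjoint T₂ x‖]) (norm_nonneg _)
  have hJ : ∀ z : K, KreinSpace.J (KreinSpace.J z) = z := fun z =>
    congrArg (fun A : K →L[ℂ] K => A z) (KreinSpace.J_mul_J (K := K))
  ext v
  refine ext_inner_right ℂ fun y => ?_
  have h1 := LinearMap.extendOfNorm_eq (denseRange_kreinAdjoint T hT)
    (f := (kreinAdjoint T₁ : K →ₗ[ℂ] V₁)) ⟨1, hn⟩ (KreinSpace.J y)
  have h2 := kreinForm_apply_left T (connecting T T₁ v) (KreinSpace.J y)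
  have h3 := kreinForm_apply_left T₁ v (KreinSpace.J y)
  simp only [kreinForm, hJ] at h2 h3
  rw [ContinuousLinearMap.comp_apply, h2, h3, connecting, adjoint_inner_left]
  exact congrArg (fun w => ⟪v, w⟫_ℂ) h1

end Krein

/-! ### The transfer mapping `C ↦ S⁻¹ C S` -/

section Transfer

variable {V W : Type*} [NormedAddCommGroup V] [NormedSpace ℂ V]
  [NormedAddCommGroup W] [NormedSpace ℂ W]

open Classical in
/-- For injective `S : V → W` and a bounded operator `C` on `W`, the bounded operator
`(S × S)⁻¹(C) = S⁻¹ C S` on `V`, i.e. the only `D` with `S D = C S`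
(and `0` if there is no such bounded operator). -/
def transfer (S : V →L[ℂ] W) (C : W →L[ℂ] W) : V →L[ℂ] V :=
  if h : ∃ D : V →L[ℂ] V, S ∘L D = C ∘L S then h.choose else 0

theorem transfer_eq (S : V →L[ℂ] W) (hS : Function.Injective S) (C : W →L[ℂ] W)
    (D : V →L[ℂ] V) (hD : S ∘L D = C ∘L S) : transfer S C = D := by
  have h : ∃ D : V →L[ℂ] V, S ∘L D = C ∘L S := ⟨D, hD⟩
  have h1 : S ∘L transfer S C = C ∘L S := by
    rw [transfer, dif_pos h]; exact h.choose_spec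
  ext v
  apply hS
  have := congrArg (fun A : V →L[ℂ] W => A v) (h1.trans hD.symm)
  simpa using this

end Transfer

/-! ### Spectral measures and integrals -/

section Spectral

/-- A (normalised) projection-valued measure on the Borel subsets of `ℂ`, acting on the Hilbert
space `H`. -/
structure ProjectionValuedMeasure (H : Type*) [NormedAddCommGroup H] [InnerProductSpace ℂ H]
    [CompleteSpace H] where
  /-- The projection belonging to a Borel set (values at other sets are irrelevant). -/
  proj : Set ℂ → H →L[ℂ] H
  isStarProjection : ∀ Δ, MeasurableSet Δ → IsStarProjection (proj Δ)
  empty : proj ∅ = 0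
  univ : proj Set.univ = 1
  inter : ∀ Δ Δ', MeasurableSet Δ → MeasurableSet Δ' → proj (Δ ∩ Δ') = proj Δ * proj Δ'
  iUnion : ∀ Δ : ℕ → Set ℂ, (∀ n, MeasurableSet (Δ n)) →
    Pairwise (Function.onFun Disjoint Δ) →
    ∀ x, HasSum (fun n => proj (Δ n) x) (proj (⋃ n, Δ n) x)

variable {H : Type*} [NormedAddCommGroup H] [InnerProductSpace ℂ H] [CompleteSpace H]

namespace ProjectionValuedMeasure

theorem inner_proj (E : ProjectionValuedMeasure H) (x : H) {Δ : Set ℂ} (hΔ : MeasurableSet Δ) :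
    (⟪x, E.proj Δ x⟫_ℂ).re = ‖E.proj Δ x‖ ^ 2 := by
  have h := E.isStarProjection Δ hΔ
  have h1 : E.proj Δ (E.proj Δ x) = E.proj Δ x :=
    congrArg (fun A : H →L[ℂ] H => A x) h.isIdempotentElem.eq
  have h2 : adjoint (E.proj Δ) = E.proj Δ := h.isSelfAdjoint
  calc (⟪x, E.proj Δ x⟫_ℂ).re = (⟪x, adjoint (E.proj Δ) (E.proj Δ x)⟫_ℂ).re := by rw [h2, h1]
    _ = (⟪E.proj Δ x, E.proj Δ x⟫_ℂ).re := by rw [adjoint_inner_right]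
    _ = ‖E.proj Δ x‖ ^ 2 := by
      rw [inner_self_eq_norm_sq_to_K]; norm_cast

/-- The finite positive measure `Δ ↦ ⟪x, E(Δ) x⟫ = ‖E(Δ) x‖²`. -/
def scalarMeasure (E : ProjectionValuedMeasure H) (x : H) : Measure ℂ :=
  Measure.ofMeasurable (fun Δ _ => ENNReal.ofReal (⟪x, E.proj Δ x⟫_ℂ).re)
    (by simp [E.empty])
    (by
      intro f hf hd
      have h1 : HasSum (fun n => (⟪x, E.proj (f n) x⟫_ℂ).re) (⟪x, E.proj (⋃ n, f n) x⟫_ℂ).re :=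
        Complex.hasSum_re ((E.iUnion f hf hd x).mapL (innerSL ℂ x))
      rw [← h1.tsum_eq, ENNReal.ofReal_tsum_of_nonneg _ h1.summable]
      intro n
      rw [E.inner_proj x (hf n)]
      positivity)

theorem scalarMeasure_apply (E : ProjectionValuedMeasure H) (x : H) {Δ : Set ℂ}
    (hΔ : MeasurableSet Δ) :
    E.scalarMeasure x Δ = ENNReal.ofReal (⟪x, E.proj Δ x⟫_ℂ).re :=
  Measure.ofMeasurable_apply Δ hΔ

/-- `B = ∫_S h dE` in the weak sense: `⟪x, B x⟫ = ∫_S h(z) d⟪x, E(z) x⟫` for all `x`. By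
polarization this determines `B` and gives the corresponding identity for `⟪y, B x⟫`. -/
def IsIntegral (E : ProjectionValuedMeasure H) (S : Set ℂ) (h : ℂ → ℂ) (B : H →L[ℂ] H) : Prop :=
  ∀ x : H, IntegrableOn h S (E.scalarMeasure x) ∧
    ⟪x, B x⟫_ℂ = ∫ z in S, h z ∂(E.scalarMeasure x)

open Classical in
/-- The operator `∫_S h dE` (and `0` if it does not exist as a bounded operator). -/
def integral (E : ProjectionValuedMeasure H) (S : Set ℂ) (h : ℂ → ℂ) : H →L[ℂ] H :=
  if hB : ∃ B, E.IsIntegral S h B then hB.choose else 0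

theorem integral_eq (E : ProjectionValuedMeasure H) (S : Set ℂ) (h : ℂ → ℂ) (B : H →L[ℂ] H)
    (hB : E.IsIntegral S h B) : E.integral S h = B := by
  have h' : ∃ B, E.IsIntegral S h B := ⟨B, hB⟩
  rw [integral, dif_pos h']
  have h1 := h'.choose_spec
  refine ContinuousLinearMap.coe_injective ((ext_inner_map _ _).1 fun x => ?_)
  have h2 : ⟪x, h'.choose x⟫_ℂ = ⟪x, B x⟫_ℂ := (h1 x).2.trans (hB x).2.symm
  simpa [inner_conj_symm] using congrArg (starRingEnd ℂ) h2

/-- `E` is the spectral measure of the bounded (normal) operator `A`: it is concentrated on the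
spectrum of `A` and `A = ∫_{σ(A)} z dE(z)`. -/
def IsSpectralMeasureOf (E : ProjectionValuedMeasure H) (A : H →L[ℂ] H) : Prop :=
  E.proj (spectrum ℂ A) = 1 ∧ E.IsIntegral (spectrum ℂ A) (fun z => z) A

end ProjectionValuedMeasure

end Spectral

end

/-! ### Bounded operators on a dense range -/

section Symmetrizable

/-! Everything rests on one principle: if `S` intertwines `A₁` with `A` and also their adjoints,
then `S` intertwines their spectral measures (`IsSpectralMeasureOf.comp_proj`), hence all bounded
integrals (`comp_integral`). It is applied to `R_j` and to the selfadjoint operators `R_j R_j*`,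
`R_j* R_j`, `T⁺T`, `T_j⁺T_j`.

To obtain `Θ(C)`, note that `[TT⁺Cx, y] = [CTT⁺x, y]` says `⟪T⁺Cx, T⁺y⟫ = ⟪T⁺x, T⁺C⁺y⟫`. An operator
with a formal adjoint for a semi-inner product is bounded for it, so `C` descends along `T⁺`. This
also gives `TΘ(C)* = C⁺T`, whence normality of `Θ(N)`, and cancelling `T` in `TR_j = T_j` gives both
intertwining relations for `R_j`. The same descent applied to a resolvent gives the spectral
inclusion.

The principle itself is a growth argument: powers of `A₁ - c` grow at most like `rⁿ` on the spectral
subspace of a disc, powers of `A - c` at least like `r'ⁿ` outside a larger disc, so `S` has no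
component between the two. Applied also to `S*`, this yields the claim for discs, which generate the
Borel sets. -/

theorem le_of_forall_pow_mul_le {q s a M : ℝ} (hs : 0 ≤ s) (ha : 0 < a)
    (h : ∀ n : ℕ, q ^ n * a ≤ M * s ^ n) : q ≤ s := by
  by_contra! hlt
  have hq : 0 < q := hs.trans_lt hlt
  have h1 : Filter.Tendsto (fun n : ℕ => M * (s / q) ^ n) Filter.atTop (nhds (M * 0)) :=
    (tendsto_pow_atTop_nhds_zero_of_lt_one (by positivity) ((div_lt_one hq).2 hlt)).const_mul M
  have h2 : a ≤ M * 0 := ge_of_tendsto' h1 fun n => by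
    rw [div_pow, ← mul_div_assoc, le_div_iff₀ (by positivity), mul_comm]
    exact h n
  linarith

/-- Log-convexity makes the ratios `a (n + 1) / a n` nondecreasing, so `a n` grows at least like
powers of the first ratio, which therefore cannot exceed `s`. -/
theorem le_mul_of_sq_le_mul_succ {a : ℕ → ℝ} {s M : ℝ} (hs : 0 ≤ s) (ha : ∀ n, 0 ≤ a n)
    (hlog : ∀ n, a (n + 1) ^ 2 ≤ a n * a (n + 2)) (hM : ∀ n, a n ≤ M * s ^ n) :
    a 1 ≤ s * a 0 := by
  rcases (ha 0).eq_or_lt with h0 | h0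
  · have := hlog 0
    rw [← h0, zero_mul] at this
    rw [← h0, mul_zero]
    exact (pow_eq_zero_iff two_ne_zero).1 (le_antisymm this (sq_nonneg _)) |>.le
  rcases (ha 1).eq_or_lt with h1 | h1
  · rw [← h1]; positivity
  set q := a 1 / a 0 with hq
  have hq0 : 0 < q := by positivity
  have hstep : ∀ n, 0 < a n ∧ q * a n ≤ a (n + 1) := by
    intro n
    induction n with
    | zero => exact ⟨h0, by rw [hq, div_mul_cancel₀ _ h0.ne']⟩
    | succ n ih =>
      have hpos : 0 < a (n + 1) := (mul_pos hq0 ih.1).trans_le ih.2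
      refine ⟨hpos, ?_⟩
      have h2 : q * a n * a (n + 1) ≤ a n * a (n + 2) := by
        nlinarith [hlog n, mul_le_mul_of_nonneg_right ih.2 hpos.le]
      exact le_of_mul_le_mul_left (by linarith) ih.1
  have hpow : ∀ n, q ^ n * a 0 ≤ a n := by
    intro n
    induction n with
    | zero => simp
    | succ n ih =>
      calc q ^ (n + 1) * a 0 = q * (q ^ n * a 0) := by ring
        _ ≤ q * a n := by gcongr
        _ ≤ a (n + 1) := (hstep n).2
  have := le_of_forall_pow_mul_le hs h0 fun n => (hpow n).trans (hM n)
  rwa [hq, div_le_iff₀ h0] at this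

variable {K V : Type*} [NormedAddCommGroup K] [InnerProductSpace ℂ K]
  [NormedAddCommGroup V] [InnerProductSpace ℂ V]

/-- An operator that is symmetric for the semi-inner product `⟪P x, P y⟫` is bounded for it. -/
theorem norm_apply_le_of_symmetric (P : K →L[ℂ] V) (A : K →L[ℂ] K)
    (hA : ∀ x y, ⟪P (A x), P y⟫_ℂ = ⟪P x, P (A y)⟫_ℂ) (x : K) :
    ‖P (A x)‖ ≤ ‖A‖ * ‖P x‖ := by
  -- Cauchy–Schwarz and symmetry make `‖P (Aⁿ x)‖` log-convex in `n`.
  have key := le_mul_of_sq_le_mul_succ (a := fun n => ‖P ((A ^ n) x)‖) (s := ‖A‖)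
    (M := ‖P‖ * ‖x‖) (norm_nonneg _) (fun n => norm_nonneg _) (fun n => ?_) (fun n => ?_)
  · simpa using key
  · have h1 : (A ^ (n + 1)) x = A ((A ^ n) x) := by rw [pow_succ']; rfl
    have h2 : (A ^ (n + 2)) x = A (A ((A ^ n) x)) := by rw [pow_succ', pow_succ']; rfl
    simp only [h1, h2]
    set y := (A ^ n) x
    calc ‖P (A y)‖ ^ 2 = ‖⟪P (A y), P (A y)⟫_ℂ‖ := by
          rw [inner_self_eq_norm_sq_to_K]; simp
      _ = ‖⟪P y, P (A (A y))⟫_ℂ‖ := by rw [hA]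
      _ ≤ _ := norm_inner_le_norm _ _
  · calc ‖P ((A ^ n) x)‖ ≤ ‖P‖ * ‖(A ^ n) x‖ := P.le_opNorm _
      _ ≤ ‖P‖ * (‖A ^ n‖ * ‖x‖) := by gcongr; exact (A ^ n).le_opNorm _
      _ ≤ ‖P‖ * (‖A‖ ^ n * ‖x‖) := by
        gcongr
        -- For `n = 0` only `‖1‖ ≤ 1` is available, since `K` may be trivial.
        rcases n.eq_zero_or_pos with rfl | hn
        · rw [pow_zero, pow_zero]; exact norm_id_le
        · exact norm_pow_le' A hn
      _ = _ := by ring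

/-- `C' * C` is symmetric for the semi-inner product, and `‖P (C x)‖² = ⟪P x, P (C' (C x))⟫`. -/
theorem norm_apply_le_of_formal_adjoint (P : K →L[ℂ] V) (C C' : K →L[ℂ] K)
    (hC : ∀ x y, ⟪P (C x), P y⟫_ℂ = ⟪P x, P (C' y)⟫_ℂ) (x : K) :
    ‖P (C x)‖ ≤ √‖C' * C‖ * ‖P x‖ := by
  have hC' : ∀ x y, ⟪P (C' x), P y⟫_ℂ = ⟪P x, P (C y)⟫_ℂ := fun x y => by
    rw [← inner_conj_symm, ← hC, inner_conj_symm]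
  have h1 := norm_apply_le_of_symmetric P (C' * C)
    (fun x y => by simp only [mul_apply_eq_comp, hC', hC]) x
  refine le_of_sq_le_sq ?_ (by positivity)
  calc ‖P (C x)‖ ^ 2 = ‖⟪P (C x), P (C x)⟫_ℂ‖ := by
        rw [inner_self_eq_norm_sq_to_K]; simp
    _ = ‖⟪P x, P ((C' * C) x)⟫_ℂ‖ := by rw [hC]; rfl
    _ ≤ ‖P x‖ * ‖P ((C' * C) x)‖ := norm_inner_le_norm _ _
    _ ≤ ‖P x‖ * (‖C' * C‖ * ‖P x‖) := by gcongr
    _ = _ := by rw [mul_pow, Real.sq_sqrt (norm_nonneg _)]; ring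

/-- An operator with a formal adjoint for the semi-inner product `⟪P x, P y⟫` induces a bounded
operator on the space in which `P` has dense range. -/
theorem exists_comp_eq_of_formal_adjoint [CompleteSpace V] (P : K →L[ℂ] V)
    (hP : DenseRange (P : K →ₗ[ℂ] V)) (C C' : K →L[ℂ] K)
    (hC : ∀ x y, ⟪P (C x), P y⟫_ℂ = ⟪P x, P (C' y)⟫_ℂ) :
    ∃ D : V →L[ℂ] V, D ∘L P = P ∘L C :=
  ⟨LinearMap.extendOfNorm ((P ∘L C : K →L[ℂ] V) : K →ₗ[ℂ] V) (P : K →ₗ[ℂ] V), by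
    ext x
    exact LinearMap.extendOfNorm_eq hP ⟨_, norm_apply_le_of_formal_adjoint P C C' hC⟩ x⟩

end Symmetrizable

/-! ### Transfer along an injective operator into a Krein space. -/

section Krein

variable {V K : Type*} [NormedAddCommGroup V] [InnerProductSpace ℂ V] [CompleteSpace V]
  [NormedAddCommGroup K] [InnerProductSpace ℂ K] [CompleteSpace K] [KreinSpace K]

theorem KreinSpace.J_J (x : K) : KreinSpace.J (KreinSpace.J x) = x :=
  congrArg (fun A : K →L[ℂ] K => A x) KreinSpace.J_mul_J

theorem KreinSpace.adjoint_J : adjoint (KreinSpace.J : K →L[ℂ] K) = KreinSpace.J :=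
  KreinSpace.isSelfAdjoint_J

theorem adjoint_kreinAdjoint (T : V →L[ℂ] K) :
    adjoint (kreinAdjoint T) = KreinSpace.J ∘L T := by
  rw [kreinAdjoint, adjoint_comp, adjoint_adjoint, KreinSpace.adjoint_J]

theorem isSelfAdjoint_kreinAdjoint_comp (T : V →L[ℂ] K) :
    IsSelfAdjoint (kreinAdjoint T ∘L T) := by
  rw [isSelfAdjoint_iff', adjoint_comp, adjoint_kreinAdjoint, kreinAdjoint]
  rfl

theorem exists_comp_eq_of_comp_kreinAdjoint_comm {T : V →L[ℂ] K} (hT : Function.Injective T)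
    {C : K →L[ℂ] K} (hC : (T ∘L kreinAdjoint T) ∘L C = C ∘L (T ∘L kreinAdjoint T)) :
    ∃ D : V →L[ℂ] V, T ∘L D = kreinAdjointEnd C ∘L T ∧ adjoint D ∘L kreinAdjoint T =
      kreinAdjoint T ∘L C := by
  obtain ⟨D, hD⟩ := exists_comp_eq_of_formal_adjoint (kreinAdjoint T)
    (denseRange_kreinAdjoint T hT) C (kreinAdjointEnd C) fun x y => by
      have hx : T (kreinAdjoint T (C x)) = C (T (kreinAdjoint T x)) :=
        congrArg (fun A : K →L[ℂ] K => A x) hC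
      rw [← kreinForm_apply_left, hx, kreinForm_end_apply_left, kreinForm_apply_left]
  refine ⟨adjoint D, ?_, by rw [adjoint_adjoint, hD]⟩
  -- The adjoint of `D T⁺ = T⁺ C` reads `J T D* = C* J T`; applying `J` turns it into `T D* = C⁺ T`.
  have h := congrArg adjoint hD
  simp only [adjoint_comp, adjoint_kreinAdjoint] at h
  ext v
  have h1 := congrArg KreinSpace.J (congrArg (fun A : V →L[ℂ] K => A v) h)
  simpa [KreinSpace.J_J, kreinAdjointEnd] using h1

/-- The transfer mapping is defined on the commutant of `T T⁺` and compatible with adjoints. -/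
theorem comp_transfer_of_comm {T : V →L[ℂ] K} (hT : Function.Injective T)
    {C : K →L[ℂ] K} (hC : (T ∘L kreinAdjoint T) ∘L C = C ∘L (T ∘L kreinAdjoint T)) :
    T ∘L transfer T C = C ∘L T ∧ T ∘L adjoint (transfer T C) = kreinAdjointEnd C ∘L T := by
  obtain ⟨D, hD, hD'⟩ := exists_comp_eq_of_comp_kreinAdjoint_comm hT hC
  -- On the dense range of `T⁺` both sides agree, because `T D* T⁺ = T T⁺ C = C T T⁺`.
  have h1 : T ∘L adjoint D = C ∘L T := by
    refine ContinuousLinearMap.coe_injective (LinearMap.ext fun v => ?_)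
    refine congrFun ((denseRange_kreinAdjoint T hT).equalizer (T ∘L adjoint D).continuous
      (C ∘L T).continuous (funext fun x => ?_)) v
    have e1 := congrArg (fun A : K →L[ℂ] V => T (A x)) hD'
    have e2 := congrArg (fun A : K →L[ℂ] K => A x) hC
    exact e1.trans e2
  rw [transfer_eq T hT C _ h1, adjoint_adjoint]
  exact ⟨h1, hD⟩

theorem isStarNormal_transfer {T : V →L[ℂ] K} (hT : Function.Injective T)
    {N : K →L[ℂ] K} (hN : (T ∘L kreinAdjoint T) ∘L N = N ∘L (T ∘L kreinAdjoint T))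
    (hNN : Commute N (kreinAdjointEnd N)) : IsStarNormal (transfer T N) := by
  obtain ⟨h1, h2⟩ := comp_transfer_of_comm hT hN
  refine ⟨?_⟩
  ext v
  apply hT
  have e1 : ∀ v, T (transfer T N v) = N (T v) := fun v =>
    congrArg (fun A : V →L[ℂ] K => A v) h1
  have e2 : ∀ v, T (star (transfer T N) v) = kreinAdjointEnd N (T v) := fun v =>
    congrArg (fun A : V →L[ℂ] K => A v) h2
  have e3 := congrArg (fun A : K →L[ℂ] K => A (T v)) hNN.eq
  simp only [mul_apply_eq_comp, e1, e2] at e3 ⊢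
  exact e3.symm

/-- After applying the injective `T`, the claim becomes the commutation of `T T⁺` with `N` on the
range of `T`. -/
theorem kreinAdjoint_comp_comm_transfer {T : V →L[ℂ] K} (hT : Function.Injective T)
    {N : K →L[ℂ] K} (hN : (T ∘L kreinAdjoint T) ∘L N = N ∘L (T ∘L kreinAdjoint T)) :
    (kreinAdjoint T ∘L T) ∘L transfer T N = transfer T N ∘L (kreinAdjoint T ∘L T) := by
  obtain ⟨h1, h2⟩ := comp_transfer_of_comm hT hN
  ext v
  apply hT
  have e1 : ∀ v, T (transfer T N v) = N (T v) := fun v =>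
    congrArg (fun A : V →L[ℂ] K => A v) h1
  have e3 := congrArg (fun A : K →L[ℂ] K => A (T v)) hN
  simpa [e1] using e3

end Krein

/-! ### Intertwining relations and spectra in Hilbert spaces. -/

section Intertwining

variable {V V₁ : Type*} [NormedAddCommGroup V] [InnerProductSpace ℂ V] [CompleteSpace V]
  [NormedAddCommGroup V₁] [InnerProductSpace ℂ V₁] [CompleteSpace V₁]

theorem adjoint_comp_eq_of_intertwining {S : V₁ →L[ℂ] V} {A₁ : V₁ →L[ℂ] V₁} {A : V →L[ℂ] V}
    (h : S ∘L adjoint A₁ = adjoint A ∘L S) : A₁ ∘L adjoint S = adjoint S ∘L A := by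
  simpa [adjoint_comp] using congrArg adjoint h

theorem comp_adjoint_comm {S : V₁ →L[ℂ] V} {A₁ : V₁ →L[ℂ] V₁} {A : V →L[ℂ] V}
    (h : S ∘L A₁ = A ∘L S) (h' : S ∘L adjoint A₁ = adjoint A ∘L S) :
    (S ∘L adjoint S) ∘L A = A ∘L (S ∘L adjoint S) := by
  rw [comp_assoc, ← adjoint_comp_eq_of_intertwining h', ← comp_assoc, h, comp_assoc]

theorem denseRange_adjoint {S : V₁ →L[ℂ] V} (hS : Function.Injective S) :
    DenseRange ((adjoint S : V →L[ℂ] V₁) : V →ₗ[ℂ] V₁) := by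
  have h : (LinearMap.range ((adjoint S : V →L[ℂ] V₁) : V →ₗ[ℂ] V₁)).topologicalClosure = ⊤ := by
    rw [Submodule.topologicalClosure_eq_top_iff, Submodule.eq_bot_iff]
    intro v hv
    have h2 : ⟪v, adjoint S (S v)⟫_ℂ = 0 :=
      (Submodule.mem_orthogonal' _ _).1 hv _ (LinearMap.mem_range_self _ (S v))
    rw [adjoint_inner_right, inner_self_eq_zero] at h2
    exact hS (by rw [h2, map_zero])
  exact (Submodule.dense_iff_topologicalClosure_eq_top).2 h

theorem exists_comp_eq_of_comp_adjoint_comm {S : V₁ →L[ℂ] V} (hS : Function.Injective S)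
    {C : V →L[ℂ] V} (hC : (S ∘L adjoint S) ∘L C = C ∘L (S ∘L adjoint S)) :
    ∃ D : V₁ →L[ℂ] V₁, S ∘L D = C ∘L S := by
  have hC' := congrArg adjoint hC
  simp only [adjoint_comp, adjoint_adjoint] at hC'
  obtain ⟨D, hD⟩ := exists_comp_eq_of_formal_adjoint (adjoint S) (denseRange_adjoint hS)
    (adjoint C) C fun x y => by
      have hx : S (adjoint S (adjoint C x)) = adjoint C (S (adjoint S x)) :=
        (congrArg (fun A : V →L[ℂ] V => A x) hC').symm
      rw [adjoint_inner_right, hx, adjoint_inner_left,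
        adjoint_inner_right]
  refine ⟨adjoint D, ?_⟩
  simpa [adjoint_comp] using congrArg adjoint hD

/-- If an injective `S` intertwines `A₁` and `A` as well as their adjoints, then
`σ(A₁) ⊆ σ(A)`. -/
theorem spectrum_subset_of_intertwining {S : V₁ →L[ℂ] V} (hS : Function.Injective S)
    {A₁ : V₁ →L[ℂ] V₁} {A : V →L[ℂ] V} (h : S ∘L A₁ = A ∘L S)
    (h' : S ∘L adjoint A₁ = adjoint A ∘L S) : spectrum ℂ A₁ ⊆ spectrum ℂ A := by
  intro z hz
  by_contra hzA
  refine hz ?_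
  rw [spectrum.notMem_iff] at hzA
  obtain ⟨u, hu⟩ := hzA
  set B₁ := algebraMap ℂ (V₁ →L[ℂ] V₁) z - A₁ with hB₁
  set U : V →L[ℂ] V := ↑u⁻¹ with hU
  have hB : ∀ v, (u : V →L[ℂ] V) (S v) = S (B₁ v) := fun v => by
    have := congrArg (fun A : V₁ →L[ℂ] V => A v) h
    simp only [comp_apply] at this
    simp [hu, hB₁, Algebra.algebraMap_eq_smul_one, this]
  have hUu : ∀ v, U ((u : V →L[ℂ] V) v) = v := fun v =>
    congrArg (fun A : V →L[ℂ] V => A v) u.inv_mul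
  have huU : ∀ v, (u : V →L[ℂ] V) (U v) = v := fun v =>
    congrArg (fun A : V →L[ℂ] V => A v) u.mul_inv
  -- The resolvent `U` commutes with `S S*` because `z - A` does; so `S⁻¹ U S` is bounded, and it
  -- inverts `z - A₁`.
  have hcomm : Commute (S ∘L adjoint S) (u : V →L[ℂ] V) := by
    rw [hu]
    exact (Algebra.commute_algebraMap_right z _).sub_right (comp_adjoint_comm h h')
  obtain ⟨D, hD⟩ := exists_comp_eq_of_comp_adjoint_comm hS (C := U) hcomm.units_inv_right.eq
  have hD' : ∀ v, S (D v) = U (S v) := fun v => congrArg (fun A : V₁ →L[ℂ] V => A v) hD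
  refine ⟨⟨B₁, D, ?_, ?_⟩, rfl⟩
  · ext v
    exact hS (by rw [mul_apply_eq_comp, ← hB, hD', huU]; rfl)
  · ext v
    exact hS (by rw [mul_apply_eq_comp, hD', ← hB, hUu]; rfl)

end Intertwining

/-! ### Bounded integrals with respect to a projection-valued measure -/

section Spectral

variable {H : Type*} [NormedAddCommGroup H] [InnerProductSpace ℂ H] [CompleteSpace H]

omit [CompleteSpace H] in
theorem ContinuousLinearMap.eq_of_inner_self_eq {B B' : H →L[ℂ] H}
    (h : ∀ x, ⟪x, B x⟫_ℂ = ⟪x, B' x⟫_ℂ) : B = B' := by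
  refine ContinuousLinearMap.coe_injective ((ext_inner_map _ _).1 fun x => ?_)
  simpa [inner_conj_symm] using congrArg (starRingEnd ℂ) (h x)

/-- Bounded measurable functions are uniform limits of simple functions. -/
theorem exists_simpleFunc_norm_sub_le {α : Type*} [MeasurableSpace α] {h : α → ℂ}
    (hm : Measurable h) {M : ℝ} (hM : ∀ z, ‖h z‖ ≤ M) {ε : ℝ} (hε : 0 < ε) :
    ∃ f : SimpleFunc α ℂ, ∀ z, ‖f z - h z‖ ≤ ε := by
  have hcover : Metric.closedBall (0 : ℂ) M ⊆
      ⋃ n, Metric.ball (TopologicalSpace.denseSeq ℂ n) ε := fun w _ => by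
    obtain ⟨n, hn⟩ := Metric.denseRange_iff.1 (TopologicalSpace.denseRange_denseSeq ℂ) w ε hε
    exact Set.mem_iUnion.2 ⟨n, hn⟩
  -- Compactness bounds the index of the dense sequence uniformly, so one nearest-point map serves
  -- all `z`.
  obtain ⟨t, ht⟩ := (isCompact_closedBall (0 : ℂ) M).elim_finite_subcover _
    (fun _ => Metric.isOpen_ball) hcover
  refine ⟨(SimpleFunc.nearestPt (TopologicalSpace.denseSeq ℂ) (t.sup id)).comp h hm, fun z => ?_⟩
  obtain ⟨k, hk, hz⟩ := Set.mem_iUnion₂.1 (ht (mem_closedBall_zero_iff.2 (hM z)))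
  have h1 := SimpleFunc.edist_nearestPt_le (TopologicalSpace.denseSeq ℂ) (h z)
    (Finset.le_sup (f := id) hk)
  rw [edist_dist, edist_dist, ENNReal.ofReal_le_ofReal_iff dist_nonneg] at h1
  rw [SimpleFunc.coe_comp, Function.comp_apply, ← dist_eq_norm]
  exact h1.trans (by rw [dist_comm]; exact hz.le)

namespace ProjectionValuedMeasure

variable (E : ProjectionValuedMeasure H)

theorem proj_apply_proj_apply {Δ Δ' : Set ℂ} (hΔ : MeasurableSet Δ) (hΔ' : MeasurableSet Δ')
    (x : H) : E.proj Δ (E.proj Δ' x) = E.proj (Δ ∩ Δ') x := by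
  rw [E.inter Δ Δ' hΔ hΔ']; rfl

theorem proj_mul_comm {Δ Δ' : Set ℂ} (hΔ : MeasurableSet Δ) (hΔ' : MeasurableSet Δ') :
    E.proj Δ * E.proj Δ' = E.proj Δ' * E.proj Δ := by
  rw [← E.inter Δ Δ' hΔ hΔ', Set.inter_comm, E.inter Δ' Δ hΔ' hΔ]

theorem adjoint_proj {Δ : Set ℂ} (hΔ : MeasurableSet Δ) : adjoint (E.proj Δ) = E.proj Δ :=
  (E.isStarProjection Δ hΔ).isSelfAdjoint

theorem inner_proj_apply_proj_apply {Δ Δ' : Set ℂ} (hΔ : MeasurableSet Δ)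
    (hΔ' : MeasurableSet Δ') (x : H) :
    ⟪E.proj Δ x, E.proj Δ' x⟫_ℂ = ⟪x, E.proj (Δ ∩ Δ') x⟫_ℂ := by
  rw [← E.proj_apply_proj_apply hΔ hΔ', ← adjoint_inner_right, E.adjoint_proj hΔ]

instance isFiniteMeasure_scalarMeasure (x : H) : IsFiniteMeasure (E.scalarMeasure x) :=
  ⟨by rw [E.scalarMeasure_apply x .univ]; exact ENNReal.ofReal_lt_top⟩

theorem scalarMeasure_real (x : H) {Δ : Set ℂ} (hΔ : MeasurableSet Δ) :
    (E.scalarMeasure x).real Δ = ‖E.proj Δ x‖ ^ 2 := by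
  rw [measureReal_def, E.scalarMeasure_apply x hΔ, E.inner_proj x hΔ,
    ENNReal.toReal_ofReal (by positivity)]

theorem scalarMeasure_real_univ (x : H) : (E.scalarMeasure x).real Set.univ = ‖x‖ ^ 2 := by
  rw [E.scalarMeasure_real x .univ, E.univ]; rfl

theorem inner_proj_eq (x : H) {Δ : Set ℂ} (hΔ : MeasurableSet Δ) :
    ⟪x, E.proj Δ x⟫_ℂ = ((E.scalarMeasure x).real Δ : ℂ) := by
  rw [E.scalarMeasure_real x hΔ]
  have h := E.inner_proj_apply_proj_apply hΔ hΔ x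
  rw [Set.inter_self, inner_self_eq_norm_sq_to_K] at h
  rw [← h]; norm_cast

theorem proj_compl {Δ : Set ℂ} (hΔ : MeasurableSet Δ) : E.proj Δᶜ = 1 - E.proj Δ := by
  refine eq_of_inner_self_eq fun x => ?_
  rw [sub_apply, inner_sub_right, E.inner_proj_eq x hΔ.compl, E.inner_proj_eq x hΔ,
    measureReal_compl hΔ, E.scalarMeasure_real_univ, one_apply_eq_self, inner_self_eq_norm_sq_to_K]
  push_cast
  rfl

theorem restrict_scalarMeasure {S : Set ℂ} (hS : MeasurableSet S) (h : E.proj S = 1) (x : H) :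
    (E.scalarMeasure x).restrict S = E.scalarMeasure x := by
  refine Measure.restrict_eq_self_of_ae_mem ?_
  rw [ae_iff]
  change E.scalarMeasure x Sᶜ = 0
  rw [E.scalarMeasure_apply x hS.compl, E.proj_compl hS, h]
  simp

theorem ae_mem_of_proj_apply_eq {Δ : Set ℂ} (hΔ : MeasurableSet Δ) {x : H}
    (hx : E.proj Δ x = x) : ∀ᵐ z ∂(E.scalarMeasure x), z ∈ Δ := by
  rw [ae_iff]
  change E.scalarMeasure x Δᶜ = 0
  rw [E.scalarMeasure_apply x hΔ.compl, E.proj_compl hΔ]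
  simp [hx]

/-- Countable additivity needs disjoint sets; each disjointed piece lies in `f n`, so `X` already
kills its projection. -/
theorem comp_proj_iUnion_eq_zero {W : Type*} [NormedAddCommGroup W] [NormedSpace ℂ W]
    (X : H →L[ℂ] W) (f : ℕ → Set ℂ) (hf : ∀ n, MeasurableSet (f n))
    (h : ∀ n, X ∘L E.proj (f n) = 0) : X ∘L E.proj (⋃ n, f n) = 0 := by
  have hd : ∀ n, MeasurableSet (disjointed f n) := fun n => .disjointed hf n
  ext x
  have h1 := (E.iUnion (disjointed f) hd (disjoint_disjointed f) x).mapL X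
  rw [iUnion_disjointed] at h1
  refine h1.unique ?_
  convert! hasSum_zero using 2 with n
  rw [← Set.inter_eq_right.2 (disjointed_subset f n), ← E.proj_apply_proj_apply (hf n) (hd n)]
  exact congrArg (fun A : H →L[ℂ] W => A _) (h n)

/-- The integral of a simple function. -/
noncomputable def simpleIntegral (f : SimpleFunc ℂ ℂ) : H →L[ℂ] H :=
  ∑ c ∈ f.range, c • E.proj (f ⁻¹' {c})

theorem inner_simpleIntegral (f : SimpleFunc ℂ ℂ) (x : H) :
    ⟪x, E.simpleIntegral f x⟫_ℂ = ∫ z, f z ∂(E.scalarMeasure x) := by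
  rw [SimpleFunc.integral_eq_sum f f.integrable_of_isFiniteMeasure, simpleIntegral, sum_apply,
    inner_sum]
  refine Finset.sum_congr rfl fun c _ => ?_
  rw [smul_apply, inner_smul_right, E.inner_proj_eq x (f.measurableSet_fiber c), mul_comm]
  simp

/-- Distinct fibres of `f` are disjoint, so the cross terms vanish. -/
theorem norm_simpleIntegral_apply_sq (f : SimpleFunc ℂ ℂ) (x : H) :
    ‖E.simpleIntegral f x‖ ^ 2 = ∫ z, ‖f z‖ ^ 2 ∂(E.scalarMeasure x) := by
  have h1 : ∫ z, ‖f z‖ ^ 2 ∂(E.scalarMeasure x)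
      = ∑ c ∈ f.range, (E.scalarMeasure x).real (f ⁻¹' {c}) • ‖c‖ ^ 2 := by
    have h2 := SimpleFunc.map_integral f (fun c : ℂ => ‖c‖ ^ 2)
      (f.integrable_of_isFiniteMeasure (μ := E.scalarMeasure x)) (by simp)
    rw [← h2, SimpleFunc.integral_eq_integral _ (SimpleFunc.integrable_of_isFiniteMeasure _)]
    rfl
  have h3 : ((‖E.simpleIntegral f x‖ ^ 2 : ℝ) : ℂ) =
      ∑ c ∈ f.range, (((E.scalarMeasure x).real (f ⁻¹' {c}) • ‖c‖ ^ 2 : ℝ) : ℂ) := by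
    have h4 := inner_self_eq_norm_sq_to_K (𝕜 := ℂ) (E.simpleIntegral f x)
    push_cast
    rw [← Complex.coe_algebraMap] at *
    refine h4.symm.trans ?_
    simp only [simpleIntegral, sum_apply, sum_inner, inner_sum, smul_apply, inner_smul_left,
      inner_smul_right]
    refine Finset.sum_congr rfl fun c hc => ?_
    rw [Finset.sum_eq_single c]
    · rw [E.inner_proj_apply_proj_apply (f.measurableSet_fiber c) (f.measurableSet_fiber c),
        Set.inter_self, E.inner_proj_eq x (f.measurableSet_fiber c), ← mul_assoc,
        Complex.mul_conj']
      simp [mul_comm]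
    · intro d _ hdc
      rw [E.inner_proj_apply_proj_apply (f.measurableSet_fiber _) (f.measurableSet_fiber _),
        ← Set.preimage_inter, Set.singleton_inter_eq_empty.2 (by simpa using hdc)]
      simp [E.empty]
    · exact fun h => absurd hc h
  rw [h1]
  exact_mod_cast h3

theorem simpleIntegral_sub (f g : SimpleFunc ℂ ℂ) :
    E.simpleIntegral (f - g) = E.simpleIntegral f - E.simpleIntegral g :=
  eq_of_inner_self_eq fun x => by
    rw [sub_apply, inner_sub_right, E.inner_simpleIntegral, E.inner_simpleIntegral,
      E.inner_simpleIntegral, ← integral_sub f.integrable_of_isFiniteMeasure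
        g.integrable_of_isFiniteMeasure]
    rfl

theorem norm_simpleIntegral_le (f : SimpleFunc ℂ ℂ) {ε : ℝ} (hε : 0 ≤ ε)
    (hf : ∀ z, ‖f z‖ ≤ ε) : ‖E.simpleIntegral f‖ ≤ ε := by
  refine opNorm_le_bound _ hε fun x => le_of_sq_le_sq ?_ (by positivity)
  rw [E.norm_simpleIntegral_apply_sq]
  calc ∫ z, ‖f z‖ ^ 2 ∂(E.scalarMeasure x) ≤ ∫ _, ε ^ 2 ∂(E.scalarMeasure x) := by
        refine integral_mono_of_nonneg (.of_forall fun z => by positivity)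
          (integrable_const _) (.of_forall fun z => ?_)
        have := hf z
        dsimp only
        gcongr
    _ = _ := by rw [integral_const, E.scalarMeasure_real_univ, smul_eq_mul]; ring

theorem integrable_scalarMeasure {h : ℂ → ℂ} (hm : Measurable h) {M : ℝ}
    (hM : ∀ z, ‖h z‖ ≤ M) (x : H) : Integrable h (E.scalarMeasure x) :=
  .of_bound hm.aestronglyMeasurable M (.of_forall hM)

/-- Uniform approximation makes the simple integrals Cauchy in operator norm; dominated convergence
identifies the limit weakly. -/
theorem exists_isIntegral_of_tendsto {h : ℂ → ℂ} (hm : Measurable h) {M : ℝ}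
    (hM : ∀ z, ‖h z‖ ≤ M) {f : ℕ → SimpleFunc ℂ ℂ}
    (hf : ∀ n z, ‖f n z - h z‖ ≤ 1 / ((n : ℝ) + 1)) :
    ∃ B, E.IsIntegral Set.univ h B ∧
      Filter.Tendsto (fun n => E.simpleIntegral (f n)) Filter.atTop (nhds B) := by
  have hlim : Filter.Tendsto (fun n : ℕ => 1 / ((n : ℝ) + 1)) Filter.atTop (nhds 0) :=
    tendsto_one_div_add_atTop_nhds_zero_nat
  have hcauchy : CauchySeq fun n => E.simpleIntegral (f n) := by
    refine cauchySeq_of_le_tendsto_0 (fun n : ℕ => 2 * (1 / ((n : ℝ) + 1))) (fun n m N hn hm' => ?_)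
      (by simpa using hlim.const_mul 2)
    rw [dist_eq_norm, ← simpleIntegral_sub]
    refine E.norm_simpleIntegral_le _ (by positivity) fun z => ?_
    have hmono : ∀ k : ℕ, N ≤ k → 1 / ((k : ℝ) + 1) ≤ 1 / ((N : ℝ) + 1) := fun k hk =>
      Nat.one_div_le_one_div hk
    calc ‖(f n - f m) z‖ = ‖(f n z - h z) - (f m z - h z)‖ := by simp
      _ ≤ ‖f n z - h z‖ + ‖f m z - h z‖ := norm_sub_le _ _
      _ ≤ 1 / ((N : ℝ) + 1) + 1 / ((N : ℝ) + 1) :=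
        add_le_add ((hf n z).trans (hmono n hn)) ((hf m z).trans (hmono m hm'))
      _ = _ := by ring
  obtain ⟨B, hB⟩ := cauchySeq_tendsto_of_complete hcauchy
  refine ⟨B, fun x => ⟨(E.integrable_scalarMeasure hm hM x).integrableOn, ?_⟩, hB⟩
  rw [Measure.restrict_univ]
  have h1 : Filter.Tendsto (fun n => ⟪x, E.simpleIntegral (f n) x⟫_ℂ) Filter.atTop
      (nhds ⟪x, B x⟫_ℂ) :=
    (tendsto_const_nhds).inner (((ContinuousLinearMap.apply ℂ H x).continuous.tendsto B).comp hB)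
  refine tendsto_nhds_unique h1 ?_
  simp only [inner_simpleIntegral]
  refine tendsto_integral_of_dominated_convergence (fun _ => M + 1)
    (fun n => (f n).aestronglyMeasurable) (integrable_const _)
    (fun n => .of_forall fun z => ?_) (.of_forall fun z => ?_)
  · calc ‖f n z‖ = ‖h z + (f n z - h z)‖ := by simp
      _ ≤ ‖h z‖ + ‖f n z - h z‖ := norm_add_le _ _
      _ ≤ M + 1 := by
        gcongr
        · exact hM z
        · refine (hf n z).trans ?_
          rw [div_le_one (by positivity)]
          linarith [n.cast_nonneg (α := ℝ)]
  · exact tendsto_iff_norm_sub_tendsto_zero.2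
      (squeeze_zero (fun _ => norm_nonneg _) (fun n => hf n z) hlim)

theorem exists_simpleFunc_seq {h : ℂ → ℂ} (hm : Measurable h) {M : ℝ} (hM : ∀ z, ‖h z‖ ≤ M) :
    ∃ f : ℕ → SimpleFunc ℂ ℂ, ∀ n z, ‖f n z - h z‖ ≤ 1 / ((n : ℝ) + 1) := by
  choose f hf using fun n : ℕ =>
    exists_simpleFunc_norm_sub_le hm hM (ε := 1 / ((n : ℝ) + 1)) (by positivity)
  exact ⟨f, hf⟩

variable {E} in
theorem IsIntegral.unique {S : Set ℂ} {h : ℂ → ℂ} {B B' : H →L[ℂ] H}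
    (hB : E.IsIntegral S h B) (hB' : E.IsIntegral S h B') : B = B' :=
  eq_of_inner_self_eq fun x => (hB x).2.trans (hB' x).2.symm

variable {E} in
theorem IsIntegral.tendsto_simpleIntegral {h : ℂ → ℂ} (hm : Measurable h) {M : ℝ}
    (hM : ∀ z, ‖h z‖ ≤ M) {f : ℕ → SimpleFunc ℂ ℂ}
    (hf : ∀ n z, ‖f n z - h z‖ ≤ 1 / ((n : ℝ) + 1)) {B : H →L[ℂ] H}
    (hB : E.IsIntegral Set.univ h B) :
    Filter.Tendsto (fun n => E.simpleIntegral (f n)) Filter.atTop (nhds B) := by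
  obtain ⟨B', hB', hlim⟩ := E.exists_isIntegral_of_tendsto hm hM hf
  rwa [hB.unique hB']

variable {E} in
-- This isometry formula is the source of the upper and lower bounds for `A - c` on spectral
-- subspaces.
theorem IsIntegral.norm_apply_sq {h : ℂ → ℂ} (hm : Measurable h) {M : ℝ}
    (hM : ∀ z, ‖h z‖ ≤ M) {B : H →L[ℂ] H} (hB : E.IsIntegral Set.univ h B) (x : H) :
    ‖B x‖ ^ 2 = ∫ z, ‖h z‖ ^ 2 ∂(E.scalarMeasure x) := by
  obtain ⟨f, hf⟩ := exists_simpleFunc_seq hm hM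
  have hlim := hB.tendsto_simpleIntegral hm hM hf
  have h1 : Filter.Tendsto (fun n => ‖E.simpleIntegral (f n) x‖ ^ 2) Filter.atTop
      (nhds (‖B x‖ ^ 2)) :=
    (((ContinuousLinearMap.apply ℂ H x).continuous.tendsto B).comp hlim).norm.pow 2
  refine tendsto_nhds_unique h1 ?_
  simp only [norm_simpleIntegral_apply_sq]
  refine tendsto_integral_of_dominated_convergence (fun _ => (M + 1) ^ 2)
    (fun n => ((f n).measurable.norm.pow_const 2).aestronglyMeasurable) (integrable_const _)
    (fun n => .of_forall fun z => ?_) (.of_forall fun z => ?_)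
  · rw [norm_pow, norm_norm]
    gcongr
    calc ‖f n z‖ = ‖h z + (f n z - h z)‖ := by simp
      _ ≤ ‖h z‖ + ‖f n z - h z‖ := norm_add_le _ _
      _ ≤ M + 1 := by
        gcongr
        · exact hM z
        · refine (hf n z).trans ?_
          rw [div_le_one (by positivity)]
          linarith [n.cast_nonneg (α := ℝ)]
  · exact (tendsto_iff_norm_sub_tendsto_zero.2 (squeeze_zero (fun _ => norm_nonneg _)
      (fun n => hf n z) tendsto_one_div_add_atTop_nhds_zero_nat)).norm.pow 2

theorem isIntegral_univ_iff_of_proj_eq_one {S : Set ℂ} (hS : MeasurableSet S)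
    (h : E.proj S = 1) (g : ℂ → ℂ) (B : H →L[ℂ] H) :
    E.IsIntegral Set.univ g B ↔ E.IsIntegral S g B := by
  simp only [IsIntegral, IntegrableOn, E.restrict_scalarMeasure hS h, Measure.restrict_univ]

theorem isIntegral_univ_indicator_iff {S : Set ℂ} (hS : MeasurableSet S) (g : ℂ → ℂ)
    (B : H →L[ℂ] H) : E.IsIntegral Set.univ (S.indicator g) B ↔ E.IsIntegral S g B := by
  simp only [IsIntegral, integrableOn_univ, integrable_indicator_iff hS, Measure.restrict_univ,
    integral_indicator hS]

end ProjectionValuedMeasure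

end Spectral

/-! ### Intertwining operators and spectral measures -/

section Spectral

variable {H H₁ : Type*} [NormedAddCommGroup H] [InnerProductSpace ℂ H] [CompleteSpace H]
  [NormedAddCommGroup H₁] [InnerProductSpace ℂ H₁] [CompleteSpace H₁]

namespace ProjectionValuedMeasure

variable {E : ProjectionValuedMeasure H} {E₁ : ProjectionValuedMeasure H₁}

theorem comp_simpleIntegral {S : H₁ →L[ℂ] H}
    (hS : ∀ Δ, MeasurableSet Δ → S ∘L E₁.proj Δ = E.proj Δ ∘L S) (f : SimpleFunc ℂ ℂ) :
    S ∘L E₁.simpleIntegral f = E.simpleIntegral f ∘L S := by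
  ext x
  have h : ∀ c : ℂ, S (E₁.proj (f ⁻¹' {c}) x) = E.proj (f ⁻¹' {c}) (S x) := fun c =>
    congrArg (fun A : H₁ →L[ℂ] H => A x) (hS _ (f.measurableSet_fiber c))
  simp [simpleIntegral, h]

theorem IsIntegral.comp_eq {S : H₁ →L[ℂ] H}
    (hS : ∀ Δ, MeasurableSet Δ → S ∘L E₁.proj Δ = E.proj Δ ∘L S) {h : ℂ → ℂ}
    (hm : Measurable h) {M : ℝ} (hM : ∀ z, ‖h z‖ ≤ M) {B₁ : H₁ →L[ℂ] H₁} {B : H →L[ℂ] H}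
    (hB₁ : E₁.IsIntegral Set.univ h B₁) (hB : E.IsIntegral Set.univ h B) :
    S ∘L B₁ = B ∘L S := by
  obtain ⟨f, hf⟩ := exists_simpleFunc_seq hm hM
  ext x
  have h1 := (S.continuous.tendsto _).comp
    (((ContinuousLinearMap.apply ℂ H₁ x).continuous.tendsto B₁).comp
      (hB₁.tendsto_simpleIntegral hm hM hf))
  have h2 := ((ContinuousLinearMap.apply ℂ H (S x)).continuous.tendsto B).comp
    (hB.tendsto_simpleIntegral hm hM hf)
  refine tendsto_nhds_unique h1 (h2.congr fun n => ?_)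
  exact (congrArg (fun A : H₁ →L[ℂ] H => A x) (comp_simpleIntegral hS (f n))).symm

theorem measurableSet_spectrum (A : H →L[ℂ] H) : MeasurableSet (spectrum ℂ A) :=
  (spectrum.isClosed A).measurableSet

theorem measurable_indicator_spectrum (A : H →L[ℂ] H) (c : ℂ) :
    Measurable ((spectrum ℂ A).indicator fun z => z - c) :=
  (measurable_id.sub_const c).indicator (measurableSet_spectrum A)

/-- Cutting `z - c` off outside the compact spectrum makes it bounded on all of `ℂ`, so the bounded
calculus applies. -/
theorem exists_norm_indicator_spectrum_le (A : H →L[ℂ] H) (c : ℂ) :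
    ∃ M : ℝ, ∀ z, ‖(spectrum ℂ A).indicator (fun z => z - c) z‖ ≤ M := by
  obtain ⟨M, hM⟩ := (spectrum.isCompact A).exists_bound_of_continuousOn
    (f := fun z : ℂ => z - c) (by fun_prop)
  refine ⟨max M 0, fun z => ?_⟩
  by_cases hz : z ∈ spectrum ℂ A
  · rw [Set.indicator_of_mem hz]; exact (hM z hz).trans (le_max_left _ _)
  · rw [Set.indicator_of_notMem hz, norm_zero]; exact le_max_right _ _

variable {A : H →L[ℂ] H} {A₁ : H₁ →L[ℂ] H₁}

theorem IsSpectralMeasureOf.isIntegral_sub (hE : E.IsSpectralMeasureOf A) (c : ℂ) :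
    E.IsIntegral Set.univ ((spectrum ℂ A).indicator fun z => z - c) (A - c • 1) := by
  rw [isIntegral_univ_indicator_iff E (measurableSet_spectrum A)]
  intro x
  obtain ⟨h1, h2⟩ := hE.2 x
  have hc : IntegrableOn (fun _ : ℂ => c) (spectrum ℂ A) (E.scalarMeasure x) := integrable_const c
  refine ⟨h1.sub hc, ?_⟩
  rw [integral_sub h1 hc, sub_apply, inner_sub_right, h2, sub_right_inj,
    E.restrict_scalarMeasure (measurableSet_spectrum A) hE.1, integral_const,
    E.scalarMeasure_real_univ, smul_apply, inner_smul_right, one_apply_eq_self,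
    inner_self_eq_norm_sq_to_K, mul_comm, Complex.real_smul]
  norm_cast

theorem IsSpectralMeasureOf.norm_sub_apply_sq (hE : E.IsSpectralMeasureOf A) (c : ℂ) (x : H) :
    ‖(A - c • 1 : H →L[ℂ] H) x‖ ^ 2 =
      ∫ z, ‖(spectrum ℂ A).indicator (fun z => z - c) z‖ ^ 2 ∂(E.scalarMeasure x) := by
  obtain ⟨M, hM⟩ := exists_norm_indicator_spectrum_le A c
  exact (hE.isIntegral_sub c).norm_apply_sq (measurable_indicator_spectrum A c) hM x

theorem IsSpectralMeasureOf.ae_norm_indicator_eq (hE : E.IsSpectralMeasureOf A) (c : ℂ)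
    {Δ : Set ℂ} (hΔ : MeasurableSet Δ) {x : H} (hx : E.proj Δ x = x) :
    ∀ᵐ z ∂(E.scalarMeasure x),
      z ∈ Δ ∧ ‖(spectrum ℂ A).indicator (fun z => z - c) z‖ = ‖z - c‖ := by
  filter_upwards [E.ae_mem_of_proj_apply_eq hΔ hx,
    E.ae_mem_of_proj_apply_eq (measurableSet_spectrum A) (x := x) (by rw [hE.1]; rfl)]
    with z hz hz'
  exact ⟨hz, by rw [Set.indicator_of_mem hz']⟩

theorem IsSpectralMeasureOf.norm_sub_apply_le (hE : E.IsSpectralMeasureOf A) {c : ℂ} {r : ℝ}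
    (hr : 0 ≤ r) {Δ : Set ℂ} (hΔ : MeasurableSet Δ) (hrΔ : ∀ z ∈ Δ, ‖z - c‖ ≤ r) {x : H}
    (hx : E.proj Δ x = x) : ‖(A - c • 1 : H →L[ℂ] H) x‖ ≤ r * ‖x‖ := by
  refine le_of_sq_le_sq ?_ (by positivity)
  rw [hE.norm_sub_apply_sq]
  calc _ ≤ ∫ _, r ^ 2 ∂(E.scalarMeasure x) := by
        refine integral_mono_of_nonneg (.of_forall fun z => by positivity)
          (integrable_const _) ?_
        filter_upwards [hE.ae_norm_indicator_eq c hΔ hx] with z hz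
        rw [hz.2]
        have := hrΔ z hz.1
        gcongr
    _ = _ := by rw [integral_const, E.scalarMeasure_real_univ, smul_eq_mul]; ring

theorem IsSpectralMeasureOf.le_norm_sub_apply (hE : E.IsSpectralMeasureOf A) {c : ℂ} {r : ℝ}
    (hr : 0 ≤ r) {Δ : Set ℂ} (hΔ : MeasurableSet Δ) (hrΔ : ∀ z ∈ Δ, r ≤ ‖z - c‖) {x : H}
    (hx : E.proj Δ x = x) : r * ‖x‖ ≤ ‖(A - c • 1 : H →L[ℂ] H) x‖ := by
  obtain ⟨M, hM⟩ := exists_norm_indicator_spectrum_le A c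
  refine le_of_sq_le_sq ?_ (norm_nonneg _)
  rw [hE.norm_sub_apply_sq]
  calc (r * ‖x‖) ^ 2 = ∫ _, r ^ 2 ∂(E.scalarMeasure x) := by
        rw [integral_const, E.scalarMeasure_real_univ, smul_eq_mul]; ring
    _ ≤ _ := by
        refine integral_mono_ae (integrable_const _) ?_ ?_
        · refine .of_bound ((measurable_indicator_spectrum A c).norm.pow_const
            2).aestronglyMeasurable (M ^ 2) (.of_forall fun z => ?_)
          rw [norm_pow, norm_norm]
          have := hM z
          gcongr
        · filter_upwards [hE.ae_norm_indicator_eq c hΔ hx] with z hz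
          rw [hz.2]
          have := hrΔ z hz.1
          gcongr

theorem IsSpectralMeasureOf.proj_sub_apply (hE : E.IsSpectralMeasureOf A) (c : ℂ) {Δ : Set ℂ}
    (hΔ : MeasurableSet Δ) (x : H) :
    E.proj Δ ((A - c • 1 : H →L[ℂ] H) x) = (A - c • 1 : H →L[ℂ] H) (E.proj Δ x) := by
  obtain ⟨M, hM⟩ := exists_norm_indicator_spectrum_le A c
  exact congrArg (fun B : H →L[ℂ] H => B x) <|
    -- The projections of `E` commute with each other, so `E.proj Δ` intertwines `E` with itself.
    IsIntegral.comp_eq (S := E.proj Δ) (fun Δ' hΔ' => E.proj_mul_comm hΔ hΔ')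
      (measurable_indicator_spectrum A c) hM (hE.isIntegral_sub c) (hE.isIntegral_sub c)

theorem IsSpectralMeasureOf.norm_sub_pow_apply_le (hE : E.IsSpectralMeasureOf A) {c : ℂ} {r : ℝ}
    (hr : 0 ≤ r) {Δ : Set ℂ} (hΔ : MeasurableSet Δ) (hrΔ : ∀ z ∈ Δ, ‖z - c‖ ≤ r) {x : H}
    (hx : E.proj Δ x = x) (n : ℕ) :
    E.proj Δ (((A - c • 1 : H →L[ℂ] H) ^ n) x) = ((A - c • 1 : H →L[ℂ] H) ^ n) x ∧
      ‖((A - c • 1 : H →L[ℂ] H) ^ n) x‖ ≤ r ^ n * ‖x‖ := by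
  induction n with
  | zero => simpa using hx
  | succ n ih =>
    rw [pow_succ', mul_apply_eq_comp]
    refine ⟨by rw [hE.proj_sub_apply c hΔ, ih.1], ?_⟩
    refine (hE.norm_sub_apply_le hr hΔ hrΔ ih.1).trans ?_
    rw [pow_succ', mul_assoc]
    exact mul_le_mul_of_nonneg_left ih.2 hr

theorem IsSpectralMeasureOf.le_norm_sub_pow_apply (hE : E.IsSpectralMeasureOf A) {c : ℂ} {r : ℝ}
    (hr : 0 ≤ r) {Δ : Set ℂ} (hΔ : MeasurableSet Δ) (hrΔ : ∀ z ∈ Δ, r ≤ ‖z - c‖) {x : H}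
    (hx : E.proj Δ x = x) (n : ℕ) :
    E.proj Δ (((A - c • 1 : H →L[ℂ] H) ^ n) x) = ((A - c • 1 : H →L[ℂ] H) ^ n) x ∧
      r ^ n * ‖x‖ ≤ ‖((A - c • 1 : H →L[ℂ] H) ^ n) x‖ := by
  induction n with
  | zero => simpa using hx
  | succ n ih =>
    rw [pow_succ', mul_apply_eq_comp]
    refine ⟨by rw [hE.proj_sub_apply c hΔ, ih.1], ?_⟩
    refine le_trans ?_ (hE.le_norm_sub_apply hr hΔ hrΔ ih.1)
    rw [pow_succ', mul_assoc]
    exact mul_le_mul_of_nonneg_left ih.2 hr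

/-- Rosenblum's argument: an intertwining operator does not connect a spectral subspace inside
a disc with one outside of a larger disc. -/
theorem IsSpectralMeasureOf.proj_comp_comp_proj_eq_zero (hE : E.IsSpectralMeasureOf A)
    (hE₁ : E₁.IsSpectralMeasureOf A₁) {S : H₁ →L[ℂ] H} (hS : S ∘L A₁ = A ∘L S) {c : ℂ}
    {r r' : ℝ} (hr : 0 ≤ r) (hrr' : r < r') {Δ Δ₁ : Set ℂ} (hΔ : MeasurableSet Δ)
    (hΔ₁ : MeasurableSet Δ₁) (hr₁ : ∀ z ∈ Δ₁, ‖z - c‖ ≤ r) (hr' : ∀ z ∈ Δ, r' ≤ ‖z - c‖) :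
    (E.proj Δ ∘L S) ∘L E₁.proj Δ₁ = 0 := by
  ext v
  set w := E₁.proj Δ₁ v with hw
  have hw' : E₁.proj Δ₁ w = w := by rw [hw, E₁.proj_apply_proj_apply hΔ₁ hΔ₁, Set.inter_self]
  set u := E.proj Δ (S w) with hu
  have hu' : E.proj Δ u = u := by rw [hu, E.proj_apply_proj_apply hΔ hΔ, Set.inter_self]
  have hX : ∀ n : ℕ, E.proj Δ (S (((A₁ - c • 1 : H₁ →L[ℂ] H₁) ^ n) w)) =
      ((A - c • 1 : H →L[ℂ] H) ^ n) u := by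
    intro n
    induction n with
    | zero => rfl
    | succ n ih =>
      have h1 : ∀ y, S ((A₁ - c • 1 : H₁ →L[ℂ] H₁) y) = (A - c • 1 : H →L[ℂ] H) (S y) := fun y => by
        have : S (A₁ y) = A (S y) := congrArg (fun B : H₁ →L[ℂ] H => B y) hS
        simp [this]
      rw [pow_succ', pow_succ', mul_apply_eq_comp, mul_apply_eq_comp, h1, hE.proj_sub_apply c hΔ,
        ih]
  change u = 0
  by_contra hne
  have hpos : 0 < ‖u‖ := norm_pos_iff.2 hne
  -- If `u ≠ 0`, then `r'ⁿ ‖u‖ ≤ ‖E(Δ) S‖ ‖w‖ rⁿ` for all `n` would force `r' ≤ r`.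
  refine hrr'.not_ge (le_of_forall_pow_mul_le (M := ‖E.proj Δ ∘L S‖ * ‖w‖) hr hpos fun n => ?_)
  calc r' ^ n * ‖u‖ ≤ ‖((A - c • 1 : H →L[ℂ] H) ^ n) u‖ :=
        (hE.le_norm_sub_pow_apply (hr.trans hrr'.le) hΔ hr' hu' n).2
    _ = ‖(E.proj Δ ∘L S) (((A₁ - c • 1 : H₁ →L[ℂ] H₁) ^ n) w)‖ := by rw [← hX]; rfl
    _ ≤ ‖E.proj Δ ∘L S‖ * ‖((A₁ - c • 1 : H₁ →L[ℂ] H₁) ^ n) w‖ := le_opNorm _ _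
    _ ≤ ‖E.proj Δ ∘L S‖ * (r ^ n * ‖w‖) := by
      gcongr
      exact (hE₁.norm_sub_pow_apply_le hr hΔ₁ hr₁ hw' n).2
    _ = _ := by ring

theorem IsSpectralMeasureOf.proj_compl_ball_comp (hE : E.IsSpectralMeasureOf A)
    (hE₁ : E₁.IsSpectralMeasureOf A₁) {S : H₁ →L[ℂ] H} (hS : S ∘L A₁ = A ∘L S) (c : ℂ)
    {ρ : ℝ} (hρ : 0 < ρ) :
    (E.proj (Metric.ball c ρ)ᶜ ∘L S) ∘L E₁.proj (Metric.ball c ρ) = 0 := by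
  have hr : ∀ n : ℕ, 0 ≤ ρ * (n / (n + 1)) ∧ ρ * (n / (n + 1) : ℝ) < ρ := fun n => by
    refine ⟨by positivity, mul_lt_of_lt_one_right hρ ?_⟩
    rw [div_lt_one (by positivity)]
    linarith
  -- Exhausting the open ball by smaller closed balls creates the gap between radii that the growth
  -- argument needs.
  have hU : Metric.ball c ρ = ⋃ n : ℕ, Metric.closedBall c (ρ * (n / (n + 1))) := by
    ext z
    rw [Set.mem_iUnion]
    refine ⟨fun hz => ?_, fun ⟨n, hz⟩ => Metric.closedBall_subset_ball (hr n).2 hz⟩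
    have h1 : Filter.Tendsto (fun n : ℕ => ρ * (n / (n + 1) : ℝ)) Filter.atTop (nhds (ρ * 1)) :=
      (tendsto_natCast_div_add_atTop (1 : ℝ)).const_mul ρ
    rw [mul_one] at h1
    obtain ⟨n, hn⟩ := (h1.eventually (lt_mem_nhds (Metric.mem_ball.1 hz))).exists
    exact ⟨n, Metric.mem_closedBall.2 hn.le⟩
  have key := E₁.comp_proj_iUnion_eq_zero (E.proj (Metric.ball c ρ)ᶜ ∘L S)
    (fun n : ℕ => Metric.closedBall c (ρ * (n / (n + 1))))
    (fun n => Metric.isClosed_closedBall.measurableSet) fun n => ?_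
  · rwa [← hU] at key
  refine hE.proj_comp_comp_proj_eq_zero hE₁ hS (c := c) (hr n).1 (hr n).2
    Metric.isOpen_ball.measurableSet.compl Metric.isClosed_closedBall.measurableSet
    (fun z hz => ?_) (fun z hz => ?_)
  · rwa [Metric.mem_closedBall, dist_eq_norm] at hz
  · rwa [Set.mem_compl_iff, Metric.mem_ball, dist_eq_norm, not_lt] at hz

/-- The vanishing corner for `S` gives `S E₁ = E S E₁`; the one for `S*`, after taking adjoints,
gives `E S = E S E₁`. -/
theorem IsSpectralMeasureOf.comp_proj_ball (hE : E.IsSpectralMeasureOf A)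
    (hE₁ : E₁.IsSpectralMeasureOf A₁) {S : H₁ →L[ℂ] H} (hS : S ∘L A₁ = A ∘L S)
    (hS' : S ∘L adjoint A₁ = adjoint A ∘L S) (c : ℂ) {ρ : ℝ} (hρ : 0 < ρ) :
    S ∘L E₁.proj (Metric.ball c ρ) = E.proj (Metric.ball c ρ) ∘L S := by
  have hb : MeasurableSet (Metric.ball c ρ) := Metric.isOpen_ball.measurableSet
  have h1 := hE.proj_compl_ball_comp hE₁ hS c hρ
  have h2 := congrArg adjoint
    (hE₁.proj_compl_ball_comp hE (adjoint_comp_eq_of_intertwining hS').symm c hρ)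
  simp only [adjoint_comp, adjoint_adjoint, E₁.adjoint_proj hb.compl, E.adjoint_proj hb,
    map_zero] at h2
  rw [E.proj_compl hb] at h1
  rw [E₁.proj_compl hb] at h2
  ext v
  have e1 := congrArg (fun B : H₁ →L[ℂ] H => B v) h1
  have e2 := congrArg (fun B : H₁ →L[ℂ] H => B v) h2
  simp only [comp_apply, sub_apply, one_apply_eq_self, map_sub, zero_apply, sub_eq_zero] at e1 e2
  exact e1.trans e2.symm

/-- An operator intertwining `A₁` and `A` as well as their adjoints intertwines the spectral
measures. -/
theorem IsSpectralMeasureOf.comp_proj (hE : E.IsSpectralMeasureOf A)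
    (hE₁ : E₁.IsSpectralMeasureOf A₁) {S : H₁ →L[ℂ] H} (hS : S ∘L A₁ = A ∘L S)
    (hS' : S ∘L adjoint A₁ = adjoint A ∘L S) (Δ : Set ℂ) (hΔ : MeasurableSet Δ) :
    S ∘L E₁.proj Δ = E.proj Δ ∘L S := by
  have hbasis : TopologicalSpace.IsTopologicalBasis
      {s : Set ℂ | ∃ c : ℂ, ∃ ρ : ℝ, 0 < ρ ∧ s = Metric.ball c ρ} := by
    refine TopologicalSpace.isTopologicalBasis_of_isOpen_of_nhds ?_ fun z u hz hu => ?_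
    · rintro _ ⟨c, ρ, _, rfl⟩
      exact Metric.isOpen_ball
    · obtain ⟨ρ, hρ, h⟩ := Metric.isOpen_iff.1 hu z hz
      exact ⟨_, ⟨z, ρ, hρ, rfl⟩, Metric.mem_ball_self hρ, h⟩
  have hgen := hbasis.borel_eq_generateFrom
  rw [← BorelSpace.measurable_eq (α := ℂ)] at hgen
  have hcompl : ∀ Δ, MeasurableSet Δ → S ∘L E₁.proj Δ = E.proj Δ ∘L S →
      S ∘L E₁.proj Δᶜ = E.proj Δᶜ ∘L S := fun Δ hΔ h => by
    rw [E₁.proj_compl hΔ, E.proj_compl hΔ, comp_sub, sub_comp, h]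
    rfl
  have hinter : ∀ Δ Δ', MeasurableSet Δ → MeasurableSet Δ' → S ∘L E₁.proj Δ = E.proj Δ ∘L S →
      S ∘L E₁.proj Δ' = E.proj Δ' ∘L S → S ∘L E₁.proj (Δ ∩ Δ') = E.proj (Δ ∩ Δ') ∘L S :=
    fun Δ Δ' hΔ hΔ' h h' => by
      rw [E₁.inter Δ Δ' hΔ hΔ', E.inter Δ Δ' hΔ hΔ']
      change S ∘L (E₁.proj Δ ∘L E₁.proj Δ') = (E.proj Δ ∘L E.proj Δ') ∘L S
      rw [← comp_assoc, h, comp_assoc, h', comp_assoc]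
  refine (MeasurableSpace.generateFrom_induction _
    (fun Δ _ => MeasurableSet Δ ∧ S ∘L E₁.proj Δ = E.proj Δ ∘L S) ?_ ?_ ?_ ?_ Δ (hgen ▸ hΔ)).2
  · rintro _ ⟨c, ρ, hρ, rfl⟩ _
    exact ⟨Metric.isOpen_ball.measurableSet, hE.comp_proj_ball hE₁ hS hS' c hρ⟩
  · exact ⟨.empty, by rw [E₁.empty, E.empty, comp_zero, zero_comp]⟩
  · exact fun Δ _ h => ⟨h.1.compl, hcompl Δ h.1 h.2⟩
  · intro f _ hf
    -- Disjointed pieces arise by successive differences, so closure under complements and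
    -- intersections covers them.
    have hd : ∀ n, MeasurableSet (disjointed f n) ∧
        S ∘L E₁.proj (disjointed f n) = E.proj (disjointed f n) ∘L S := fun n =>
      disjointedRec (p := fun Δ => MeasurableSet Δ ∧ S ∘L E₁.proj Δ = E.proj Δ ∘L S)
        (fun Δ i h => by
          rw [Set.sdiff_eq]
          exact ⟨h.1.inter (hf i).1.compl, hinter _ _ h.1 (hf i).1.compl h.2
            (hcompl _ (hf i).1 (hf i).2)⟩) (hf n)
    refine ⟨.iUnion fun n => (hf n).1, ?_⟩
    rw [← iUnion_disjointed]
    ext v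
    have h1 := (E₁.iUnion _ (fun n => (hd n).1) (disjoint_disjointed f) v).mapL S
    have h2 := E.iUnion _ (fun n => (hd n).1) (disjoint_disjointed f) (S v)
    refine h1.unique ?_
    convert! h2 using 2 with n
    exact congrArg (fun B : H₁ →L[ℂ] H => B v) (hd n).2

/-! ### Bounded measurable functions on the spectrum -/

theorem measurable_indicator_of_measurable_subtype {S : Set ℂ} (hS : MeasurableSet S)
    {h : ℂ → ℂ} (hm : Measurable fun z : S => h z) : Measurable (S.indicator h) := by
  refine measurable_of_restrict_of_restrict_compl hS ?_ ?_
  · convert! hm using 1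
    ext z
    simp
  · convert! measurable_const (a := (0 : ℂ)) using 1
    ext z
    simpa using fun hz => absurd hz z.2

theorem isIntegral_integral {S : Set ℂ} (hS : MeasurableSet S) {h : ℂ → ℂ}
    (hm : Measurable fun z : S => h z) {M : ℝ} (hM : ∀ z ∈ S, ‖h z‖ ≤ M) :
    E.IsIntegral S h (E.integral S h) := by
  have hm' := measurable_indicator_of_measurable_subtype hS hm
  have hM' : ∀ z, ‖S.indicator h z‖ ≤ max M 0 := fun z => by
    by_cases hz : z ∈ S
    · rw [Set.indicator_of_mem hz]; exact (hM z hz).trans (le_max_left _ _)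
    · rw [Set.indicator_of_notMem hz, norm_zero]; exact le_max_right _ _
  obtain ⟨f, hf⟩ := exists_simpleFunc_seq hm' hM'
  obtain ⟨B, hB, -⟩ := E.exists_isIntegral_of_tendsto hm' hM' hf
  rw [isIntegral_univ_indicator_iff E hS] at hB
  rwa [E.integral_eq S h B hB]

/-- An operator intertwining the spectral measures intertwines the integrals. -/
theorem comp_integral {S : H₁ →L[ℂ] H}
    (hS : ∀ Δ, MeasurableSet Δ → S ∘L E₁.proj Δ = E.proj Δ ∘L S) {s s₁ : Set ℂ}
    (hs : MeasurableSet s) (hs₁ : MeasurableSet s₁) (hss : s₁ ⊆ s)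
    (hE₁ : E₁.proj s₁ = 1) {h : ℂ → ℂ}
    (hm : Measurable fun z : s => h z) {M : ℝ} (hM : ∀ z ∈ s, ‖h z‖ ≤ M) :
    S ∘L E₁.integral s₁ h = E.integral s h ∘L S := by
  have hm' := measurable_indicator_of_measurable_subtype hs hm
  have hM' : ∀ z, ‖s.indicator h z‖ ≤ max M 0 := fun z => by
    by_cases hz : z ∈ s
    · rw [Set.indicator_of_mem hz]; exact (hM z hz).trans (le_max_left _ _)
    · rw [Set.indicator_of_notMem hz, norm_zero]; exact le_max_right _ _
  -- `E₁` is also carried by the larger set `s`, so both integrals can use the same function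
  -- `s.indicator h`.
  have hE₁s : E₁.proj s = 1 := by
    have := E₁.inter s₁ s hs₁ hs
    rwa [Set.inter_eq_left.2 hss, hE₁, one_mul, eq_comm] at this
  refine IsIntegral.comp_eq hS hm' hM' ?_ ?_
  · rw [isIntegral_univ_indicator_iff E₁ hs, ← isIntegral_univ_iff_of_proj_eq_one E₁ hs hE₁s,
      isIntegral_univ_iff_of_proj_eq_one E₁ hs₁ hE₁]
    exact isIntegral_integral hs₁ (hm.comp (measurable_inclusion hss)) fun z hz => hM z (hss hz)
  · rw [isIntegral_univ_indicator_iff E hs]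
    exact isIntegral_integral hs hm hM

end ProjectionValuedMeasure

end Spectral

/-! ### Selfadjoint commutants, the operators `R_j`, and the theorem. -/

section Connecting

variable {H H₁ : Type*} [NormedAddCommGroup H] [InnerProductSpace ℂ H] [CompleteSpace H]
  [NormedAddCommGroup H₁] [InnerProductSpace ℂ H₁] [CompleteSpace H₁]

omit [CompleteSpace H] in
theorem mem_centralizer_singleton_iff_comp {X B : H →L[ℂ] H} :
    B ∈ Set.centralizer {X} ↔ X ∘L B = B ∘L X := by
  rw [Set.mem_centralizer_iff]
  exact ⟨fun h => h X rfl, fun h m hm => by rw [Set.mem_singleton_iff.1 hm]; exact h⟩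

theorem isSelfAdjoint_comp_adjoint (S : H₁ →L[ℂ] H) : IsSelfAdjoint (S ∘L adjoint S) := by
  rw [isSelfAdjoint_iff', adjoint_comp, adjoint_adjoint]

theorem isSelfAdjoint_adjoint_comp (S : H₁ →L[ℂ] H) : IsSelfAdjoint (adjoint S ∘L S) := by
  rw [isSelfAdjoint_iff', adjoint_comp, adjoint_adjoint]

theorem adjoint_comp_comm {S : H₁ →L[ℂ] H} {A₁ : H₁ →L[ℂ] H₁} {A : H →L[ℂ] H}
    (h : S ∘L A₁ = A ∘L S) (h' : S ∘L adjoint A₁ = adjoint A ∘L S) :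
    (adjoint S ∘L S) ∘L A₁ = A₁ ∘L (adjoint S ∘L S) := by
  rw [comp_assoc, h, ← comp_assoc, ← adjoint_comp_eq_of_intertwining h', comp_assoc]

/-- For selfadjoint `X`, the adjoint of `XA = AX` is the required relation with `A*`. -/
theorem ProjectionValuedMeasure.IsSpectralMeasureOf.comp_proj_of_comm
    {E : ProjectionValuedMeasure H} {A X : H →L[ℂ] H} (hE : E.IsSpectralMeasureOf A)
    (hX : IsSelfAdjoint X) (h : X ∘L A = A ∘L X) (Δ : Set ℂ) (hΔ : MeasurableSet Δ) :
    X ∘L E.proj Δ = E.proj Δ ∘L X :=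
  hE.comp_proj hE h (by simpa [adjoint_comp, hX.adjoint_eq] using (congrArg adjoint h).symm) Δ hΔ

theorem intertwining_of_comp_eq {K : Type*} [NormedAddCommGroup K] [InnerProductSpace ℂ K]
    [CompleteSpace K] [KreinSpace K] {T : H →L[ℂ] K} {T₁ : H₁ →L[ℂ] K}
    (hT : Function.Injective T) (hT₁ : Function.Injective T₁) {R : H₁ →L[ℂ] H}
    (hR : T ∘L R = T₁) {N : K →L[ℂ] K}
    (hN : (T ∘L kreinAdjoint T) ∘L N = N ∘L (T ∘L kreinAdjoint T))
    (hN₁ : (T₁ ∘L kreinAdjoint T₁) ∘L N = N ∘L (T₁ ∘L kreinAdjoint T₁)) :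
    R ∘L transfer T₁ N = transfer T N ∘L R ∧
      R ∘L adjoint (transfer T₁ N) = adjoint (transfer T N) ∘L R ∧ Function.Injective R := by
  -- Cancelling `T` in `T R D₁ = T₁ D₁ = C T₁ = C T R = T D R`; used for `C = N` and for `C = N⁺`.
  have key : ∀ {D₁ : H₁ →L[ℂ] H₁} {D : H →L[ℂ] H} {C : K →L[ℂ] K}, T ∘L D = C ∘L T →
      T₁ ∘L D₁ = C ∘L T₁ → R ∘L D₁ = D ∘L R := fun {D₁ D C} h h₁ => by
    have e : T ∘L (R ∘L D₁) = T ∘L (D ∘L R) := by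
      rw [← comp_assoc, hR, h₁, ← comp_assoc, h, comp_assoc, hR]
    ext v
    exact hT (congrArg (fun B : H₁ →L[ℂ] K => B v) e)
  obtain ⟨h, h'⟩ := comp_transfer_of_comm hT hN
  obtain ⟨h₁, h₁'⟩ := comp_transfer_of_comm hT₁ hN₁
  refine ⟨key h h₁, key h' h₁', fun v w hvw => hT₁ ?_⟩
  rw [← hR, comp_apply, comp_apply, hvw]

end Connecting

theorem mainTheorem9
    {K V V₁ V₂ : Type*}
    [NormedAddCommGroup K] [InnerProductSpace ℂ K] [CompleteSpace K] [KreinSpace K]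
    [NormedAddCommGroup V] [InnerProductSpace ℂ V] [CompleteSpace V]
    [NormedAddCommGroup V₁] [InnerProductSpace ℂ V₁] [CompleteSpace V₁]
    [NormedAddCommGroup V₂] [InnerProductSpace ℂ V₂] [CompleteSpace V₂]
    (T : V →L[ℂ] K) (T₁ : V₁ →L[ℂ] K) (T₂ : V₂ →L[ℂ] K)
    (hT : Function.Injective T) (hT₁ : Function.Injective T₁) (hT₂ : Function.Injective T₂)
    (hsum : T ∘L kreinAdjoint T = T₁ ∘L kreinAdjoint T₁ + T₂ ∘L kreinAdjoint T₂)
    (N : K →L[ℂ] K) (hN : Commute N (kreinAdjointEnd N))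
    (hN₁ : N ∈ Set.centralizer {T₁ ∘L kreinAdjoint T₁})
    (hN₂ : N ∈ Set.centralizer {T₂ ∘L kreinAdjoint T₂}) :
    let R₁ : V₁ →L[ℂ] V := connecting T T₁
    let R₂ : V₂ →L[ℂ] V := connecting T T₂
    let ΘN : V →L[ℂ] V := transfer T N
    let Θ₁N : V₁ →L[ℂ] V₁ := transfer T₁ N
    let Θ₂N : V₂ →L[ℂ] V₂ := transfer T₂ N
    let Γ₁ : (V →L[ℂ] V) → (V₁ →L[ℂ] V₁) := transfer R₁
    let Γ₂ : (V →L[ℂ] V) → (V₂ →L[ℂ] V₂) := transfer R₂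
    -- `Θ(N)`, `Θ₁(N)`, `Θ₂(N)` exist as bounded operators
    (T ∘L ΘN = N ∘L T ∧ T₁ ∘L Θ₁N = N ∘L T₁ ∧ T₂ ∘L Θ₂N = N ∘L T₂) ∧
    -- and are normal
    (IsStarNormal ΘN ∧ IsStarNormal Θ₁N ∧ IsStarNormal Θ₂N) ∧
    -- functions on `σ(Θ(N))` can be restricted to `σ(Θ_j(N))`
    (spectrum ℂ Θ₁N ⊆ spectrum ℂ ΘN ∧ spectrum ℂ Θ₂N ⊆ spectrum ℂ ΘN) ∧
    ∀ (E : ProjectionValuedMeasure V) (E₁ : ProjectionValuedMeasure V₁)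
      (E₂ : ProjectionValuedMeasure V₂),
      E.IsSpectralMeasureOf ΘN → E₁.IsSpectralMeasureOf Θ₁N → E₂.IsSpectralMeasureOf Θ₂N →
      (∀ Δ : Set ℂ, MeasurableSet Δ →
        E.proj Δ ∈ Set.centralizer {R₁ ∘L adjoint R₁} ∩ Set.centralizer {R₂ ∘L adjoint R₂} ∩
          Set.centralizer {kreinAdjoint T ∘L T} ∧
        -- `Γ_j(E(Δ))` exists as a bounded operator
        (R₁ ∘L Γ₁ (E.proj Δ) = E.proj Δ ∘L R₁ ∧ R₂ ∘L Γ₂ (E.proj Δ) = E.proj Δ ∘L R₂) ∧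
        (Γ₁ (E.proj Δ) = E₁.proj Δ ∧ Γ₂ (E.proj Δ) = E₂.proj Δ) ∧
        E₁.proj Δ ∈ Set.centralizer {adjoint R₁ ∘L R₁} ∩
          Set.centralizer {kreinAdjoint T₁ ∘L T₁} ∧
        E₂.proj Δ ∈ Set.centralizer {adjoint R₂ ∘L R₂} ∩
          Set.centralizer {kreinAdjoint T₂ ∘L T₂}) ∧
      (∀ h : ℂ → ℂ, Measurable (fun z : spectrum ℂ ΘN => h z) →
        (∃ M : ℝ, ∀ z ∈ spectrum ℂ ΘN, ‖h z‖ ≤ M) →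
        let B : V →L[ℂ] V := E.integral (spectrum ℂ ΘN) h
        let B₁ : V₁ →L[ℂ] V₁ := E₁.integral (spectrum ℂ Θ₁N) h
        let B₂ : V₂ →L[ℂ] V₂ := E₂.integral (spectrum ℂ Θ₂N) h
        -- the three integrals exist as bounded operators
        (E.IsIntegral (spectrum ℂ ΘN) h B ∧ E₁.IsIntegral (spectrum ℂ Θ₁N) h B₁ ∧
          E₂.IsIntegral (spectrum ℂ Θ₂N) h B₂) ∧
        B ∈ Set.centralizer {R₁ ∘L adjoint R₁} ∩ Set.centralizer {R₂ ∘L adjoint R₂} ∩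
          Set.centralizer {kreinAdjoint T ∘L T} ∧
        -- `Γ_j(∫ h dE)` exists as a bounded operator
        (R₁ ∘L Γ₁ B = B ∘L R₁ ∧ R₂ ∘L Γ₂ B = B ∘L R₂) ∧
        (Γ₁ B = B₁ ∧ Γ₂ B = B₂) ∧
        B₁ ∈ Set.centralizer {adjoint R₁ ∘L R₁} ∩ Set.centralizer {kreinAdjoint T₁ ∘L T₁} ∧
        B₂ ∈ Set.centralizer {adjoint R₂ ∘L R₂} ∩ Set.centralizer {kreinAdjoint T₂ ∘L T₂}) := by
  intro R₁ R₂ ΘN Θ₁N Θ₂N Γ₁ Γ₂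
  have hR₁ : T ∘L R₁ = T₁ := comp_connecting T T₁ T₂ hT hsum
  have hR₂ : T ∘L R₂ = T₂ := comp_connecting T T₂ T₁ hT (by rw [hsum, add_comm])
  have hN₁' : (T₁ ∘L kreinAdjoint T₁) ∘L N = N ∘L (T₁ ∘L kreinAdjoint T₁) :=
    Set.mem_centralizer_iff.1 hN₁ _ rfl
  have hN₂' : (T₂ ∘L kreinAdjoint T₂) ∘L N = N ∘L (T₂ ∘L kreinAdjoint T₂) :=
    Set.mem_centralizer_iff.1 hN₂ _ rfl
  have hN' : (T ∘L kreinAdjoint T) ∘L N = N ∘L (T ∘L kreinAdjoint T) := by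
    rw [hsum, add_comp, comp_add, hN₁', hN₂']
  obtain ⟨i₁, i₁', inj₁⟩ := intertwining_of_comp_eq hT hT₁ hR₁ hN' hN₁'
  obtain ⟨i₂, i₂', inj₂⟩ := intertwining_of_comp_eq hT hT₂ hR₂ hN' hN₂'
  have hσ₁ := spectrum_subset_of_intertwining inj₁ i₁ i₁'
  have hσ₂ := spectrum_subset_of_intertwining inj₂ i₂ i₂'
  refine ⟨⟨(comp_transfer_of_comm hT hN').1, (comp_transfer_of_comm hT₁ hN₁').1,
      (comp_transfer_of_comm hT₂ hN₂').1⟩,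
    ⟨isStarNormal_transfer hT hN' hN, isStarNormal_transfer hT₁ hN₁' hN,
      isStarNormal_transfer hT₂ hN₂' hN⟩, ⟨hσ₁, hσ₂⟩, fun E E₁ E₂ hE hE₁ hE₂ => ?_⟩
  have p₁ := hE.comp_proj hE₁ i₁ i₁'
  have p₂ := hE.comp_proj hE₂ i₂ i₂'
  have q₁ := hE.comp_proj_of_comm (isSelfAdjoint_comp_adjoint R₁) (comp_adjoint_comm i₁ i₁')
  have q₂ := hE.comp_proj_of_comm (isSelfAdjoint_comp_adjoint R₂) (comp_adjoint_comm i₂ i₂')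
  have q := hE.comp_proj_of_comm (isSelfAdjoint_kreinAdjoint_comp T)
    (kreinAdjoint_comp_comm_transfer hT hN')
  have r₁ := hE₁.comp_proj_of_comm (isSelfAdjoint_adjoint_comp R₁) (adjoint_comp_comm i₁ i₁')
  have r₂ := hE₂.comp_proj_of_comm (isSelfAdjoint_adjoint_comp R₂) (adjoint_comp_comm i₂ i₂')
  have t₁ := hE₁.comp_proj_of_comm (isSelfAdjoint_kreinAdjoint_comp T₁)
    (kreinAdjoint_comp_comm_transfer hT₁ hN₁')
  have t₂ := hE₂.comp_proj_of_comm (isSelfAdjoint_kreinAdjoint_comp T₂)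
    (kreinAdjoint_comp_comm_transfer hT₂ hN₂')
  refine ⟨fun Δ hΔ => ?_, fun h hm ⟨M, hM⟩ => ?_⟩
  · have g₁ : Γ₁ (E.proj Δ) = E₁.proj Δ := transfer_eq R₁ inj₁ _ _ (p₁ Δ hΔ)
    have g₂ : Γ₂ (E.proj Δ) = E₂.proj Δ := transfer_eq R₂ inj₂ _ _ (p₂ Δ hΔ)
    simp only [Set.mem_inter_iff, mem_centralizer_singleton_iff_comp]
    exact ⟨⟨⟨q₁ Δ hΔ, q₂ Δ hΔ⟩, q Δ hΔ⟩, ⟨by rw [g₁, p₁ Δ hΔ], by rw [g₂, p₂ Δ hΔ]⟩, ⟨g₁, g₂⟩,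
      ⟨r₁ Δ hΔ, t₁ Δ hΔ⟩, ⟨r₂ Δ hΔ, t₂ Δ hΔ⟩⟩
  · intro B B₁ B₂
    have s := ProjectionValuedMeasure.measurableSet_spectrum ΘN
    have s₁ := ProjectionValuedMeasure.measurableSet_spectrum Θ₁N
    have s₂ := ProjectionValuedMeasure.measurableSet_spectrum Θ₂N
    have hm₁ : Measurable fun z : spectrum ℂ Θ₁N => h z := hm.comp (measurable_inclusion hσ₁)
    have hm₂ : Measurable fun z : spectrum ℂ Θ₂N => h z := hm.comp (measurable_inclusion hσ₂)
    have hM₁ : ∀ z ∈ spectrum ℂ Θ₁N, ‖h z‖ ≤ M := fun z hz => hM z (hσ₁ hz)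
    have hM₂ : ∀ z ∈ spectrum ℂ Θ₂N, ‖h z‖ ≤ M := fun z hz => hM z (hσ₂ hz)
    -- Since `R₁` is injective, this relation both shows that `Γ₁ B` exists and identifies it.
    have c₁ : R₁ ∘L B₁ = B ∘L R₁ :=
      ProjectionValuedMeasure.comp_integral p₁ s s₁ hσ₁ hE₁.1 hm hM
    have c₂ : R₂ ∘L B₂ = B ∘L R₂ :=
      ProjectionValuedMeasure.comp_integral p₂ s s₂ hσ₂ hE₂.1 hm hM
    have g₁ : Γ₁ B = B₁ := transfer_eq R₁ inj₁ _ _ c₁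
    have g₂ : Γ₂ B = B₂ := transfer_eq R₂ inj₂ _ _ c₂
    simp only [Set.mem_inter_iff, mem_centralizer_singleton_iff_comp]
    exact ⟨⟨ProjectionValuedMeasure.isIntegral_integral s hm hM,
        ProjectionValuedMeasure.isIntegral_integral s₁ hm₁ hM₁,
        ProjectionValuedMeasure.isIntegral_integral s₂ hm₂ hM₂⟩,
      ⟨⟨ProjectionValuedMeasure.comp_integral q₁ s s subset_rfl hE.1 hm hM,
        ProjectionValuedMeasure.comp_integral q₂ s s subset_rfl hE.1 hm hM⟩,
        ProjectionValuedMeasure.comp_integral q s s subset_rfl hE.1 hm hM⟩,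
      ⟨by rw [g₁, c₁], by rw [g₂, c₂]⟩, ⟨g₁, g₂⟩,
      ⟨ProjectionValuedMeasure.comp_integral r₁ s₁ s₁ subset_rfl hE₁.1 hm₁ hM₁,
        ProjectionValuedMeasure.comp_integral t₁ s₁ s₁ subset_rfl hE₁.1 hm₁ hM₁⟩,
      ⟨ProjectionValuedMeasure.comp_integral r₂ s₂ s₂ subset_rfl hE₂.1 hm₂ hM₂,
        ProjectionValuedMeasure.comp_integral t₂ s₂ s₂ subset_rfl hE₂.1 hm₂ hM₂⟩⟩
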